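/- **Setting.** Let $n\ge 1$ be the number of generators. Let $M=\mathrm{diag}(M_i)$, $T'_{do}=\mathrm{diag}(T'_{do\,i})$, $T_A=\mathrm{diag}(T_{Ai})$ have positive diagonal entries, let $D=\mathrm{diag}(D_i)$, and let $L_1,L_2,L_3,F_1,F_2,F_3\in\mathbb R^{n\times n}$, where $L_1,L_2,L_3$ have zero row sums. Assume that $F_1$ is nonsingular and (weakly) row diagonally dominant, $\sum_{j\ne i}|[F_1]_{ij}|\le |[F_1]_{ii}|$ for all $i$, and that its diagonal entries are all $\ge 0$ or all $\le 0$. Put $$A=\begin{bmatrix}0&I&0&0\\ L_{1m}&-D_m&F_{1m}&0\\ L_{2m}&0&F_{2m}&I\\ L_{3m}&0&F_{3m}&-I\end{bmatrix},\qquad B=\begin{bmatrix}0\\0\\0\\B_1\end{bmatrix},\qquad B_1=M^{1/2}T_A^{-1},$$ with $L_{1m}=M^{-1/2}L_1M^{-1/2}$, $L_{2m}=M^{1/2}T_{do}'^{-1}L_2M^{-1/2}$, $L_{3m}=M^{1/2}T_A^{-1}L_3M^{-1/2}$, $D_m=M^{-1/2}DM^{-1/2}$, $F_{1m}=M^{-1/2}F_1M^{-1/2}$,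 $F_{2m}=M^{1/2}T_{do}'^{-1}F_2M^{-1/2}$, $F_{3m}=M^{1/2}T_A^{-1}F_3M^{-1/2}$. Let $$\bar v=\frac{M^{1/2}\mathbf 1_n}{\sqrt{\mathrm{tr}(M)}},\qquad v_0=[\bar v^T\ 0\ 0\ 0]^T .$$ Let $Q\in\mathbb R^{4n\times 4n}$, $Q\succeq0$, have null space exactly $\mathrm{span}\{v_0\}$, and let $R\in\mathbb R^{n\times n}$, $R\succ0$. A *clustering set* is a family $\mathcal I=\{\mathcal I_1,\dots,\mathcal I_r\}$, $r\geq 1$, of nonempty, pairwise disjoint sets with union $\{1,\dots,n\}$. Given $\mathcal I$, choose the clustering weight $w=\bar v$ and let $P\in\mathbb R^{r\times n}$, $P_{ij}=w_j/\|w_{\mathcal I_i}\|_2$ for $j\in\mathcal I_i$ and $P_{ij}=0$ otherwise, where $\|w_{\mathcal I_i}\|_2=(\sum_{k\in\mathcal I_i}w_k^2)^{1/2}$. Put $\Pi=I_4\otimes P$, $\tilde A=\Pi A\Pi^T$, $\tilde B=\Pi B$, $\tilde Q=\Pi Q\Pi^T$, $\tilde v_0=\Pi v_0$. Assume that $\tilde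 A$ has an eigenvalue decomposition in which $\tilde v_0$ is the eigenvector of the eigenvalue $0$, at least to the extent that there is a real vector $\tilde w_0$ with $$\tilde w_0^T\tilde A=0,\qquad \tilde w_0^T\tilde v_0=1. \tag{1}$$ **Theorem.** For every clustering set as above there is a matrix $\hat K\in\mathbb R^{n\times 4n}$ with the following properties. (i) For every $\epsilon>0$ and every real $\tilde w_0$ satisfying (1), $\hat K$ is the controller produced by the control inversion steps. That is, with $\tilde A_\epsilon=\tilde A-\epsilon\tilde v_0\tilde w_0^T$, the algebraic Riccati equation $$\tilde A_\epsilon^T\tilde X+\tilde X\tilde A_\epsilon+\tilde Q-\tilde X\tilde BR^{-1}\tilde B^T\tilde X=0$$ has a solution $\tilde X\succeq0$ for which $\tilde A_\epsilon-\tilde BR^{-1}\tilde B^T\tilde X$ is Hurwitz; $\tilde X$ is the only positive semidefinite solution and the only symmetric stabilizing solution; and $\hat K=R^{-1}B^T\,\Pi^T\tilde X\,\Pi$. In particular, $\hat K$ is unique and depends neither on $\epsilon$ nor on the choice of $\tilde w_0$. (ii) $\hat K$ preserves the angular consensus: $v_0\neq 0$ and $(A-B\hat K)v_0=0$, that is,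 $A-B\hat K$ has the eigenvalue $0$ with eigenvector $v_0$. -/

import Mathlib

open Matrix
open scoped Kronecker

noncomputable section

/-- Small-signal data of a power network with `n` generators: inertias `M`, dampings `D`, time
constants `Tdo` and `TA`, matrices `L₁, L₂, L₃` with zero row sums, and matrices `F₁, F₂, F₃`. -/
structure PowerSystem (n : ℕ) where
  M : Fin n → ℝ
  D : Fin n → ℝ
  Tdo : Fin n → ℝ
  TA : Fin n → ℝ
  L₁ : Matrix (Fin n) (Fin n) ℝ
  L₂ : Matrix (Fin n) (Fin n) ℝ
  L₃ : Matrix (Fin n) (Fin n) ℝ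
  F₁ : Matrix (Fin n) (Fin n) ℝ
  F₂ : Matrix (Fin n) (Fin n) ℝ
  F₃ : Matrix (Fin n) (Fin n) ℝ
  M_pos : ∀ i, 0 < M i
  Tdo_pos : ∀ i, 0 < Tdo i
  TA_pos : ∀ i, 0 < TA i
  L₁_rowSum : ∀ i, ∑ j, L₁ i j = 0
  L₂_rowSum : ∀ i, ∑ j, L₂ i j = 0
  L₃_rowSum : ∀ i, ∑ j, L₃ i j = 0

namespace PowerSystem

variable {n : ℕ} (S : PowerSystem n)

/-- `M^{1/2}`. -/
def sqrtM : Matrix (Fin n) (Fin n) ℝ := diagonal fun i => √(S.M i)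

/-- `M^{-1/2}`. -/
def invSqrtM : Matrix (Fin n) (Fin n) ℝ := diagonal fun i => (√(S.M i))⁻¹

/-- `Tdo⁻¹`. -/
def invTdo : Matrix (Fin n) (Fin n) ℝ := diagonal fun i => (S.Tdo i)⁻¹

/-- `TA⁻¹`. -/
def invTA : Matrix (Fin n) (Fin n) ℝ := diagonal fun i => (S.TA i)⁻¹

def L₁m : Matrix (Fin n) (Fin n) ℝ := S.invSqrtM * S.L₁ * S.invSqrtM
def L₂m : Matrix (Fin n) (Fin n) ℝ := S.sqrtM * S.invTdo * S.L₂ * S.invSqrtM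
def L₃m : Matrix (Fin n) (Fin n) ℝ := S.sqrtM * S.invTA * S.L₃ * S.invSqrtM
def Dm : Matrix (Fin n) (Fin n) ℝ := S.invSqrtM * diagonal S.D * S.invSqrtM
def F₁m : Matrix (Fin n) (Fin n) ℝ := S.invSqrtM * S.F₁ * S.invSqrtM
def F₂m : Matrix (Fin n) (Fin n) ℝ := S.sqrtM * S.invTdo * S.F₂ * S.invSqrtM
def F₃m : Matrix (Fin n) (Fin n) ℝ := S.sqrtM * S.invTA * S.F₃ * S.invSqrtM
def B₁ : Matrix (Fin n) (Fin n) ℝ := S.sqrtM * S.invTA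

/-- The `4n × 4n` state matrix; the index `(a, i)` is the `i`-th entry of the state block `x_a`. -/
def A : Matrix (Fin 4 × Fin n) (Fin 4 × Fin n) ℝ :=
  Matrix.comp (Fin 4) (Fin 4) (Fin n) (Fin n) ℝ
    !![0, 1, 0, 0;
       S.L₁m, -S.Dm, S.F₁m, 0;
       S.L₂m, 0, S.F₂m, 1;
       S.L₃m, 0, S.F₃m, -1]

/-- The `4n × n` input matrix `[0; 0; 0; B₁]`. -/
def B : Matrix (Fin 4 × Fin n) (Fin n) ℝ :=
  Matrix.of fun p j => if p.1 = 3 then S.B₁ p.2 j else 0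

/-- `v̄ = M^{1/2} 1 / √(tr M)`. -/
def vbar : Fin n → ℝ := fun i => √(S.M i) / √(∑ k, S.M k)

/-- The consensus vector `v₀ = [v̄; 0; 0; 0]`. -/
def v₀ : Fin 4 × Fin n → ℝ := fun p => if p.1 = 0 then S.vbar p.2 else 0

end PowerSystem

/-- Row diagonal dominance (not necessarily strict). -/
def IsDiagDominant {n : ℕ} (F : Matrix (Fin n) (Fin n) ℝ) : Prop :=
  ∀ i, ∑ j ∈ Finset.univ.erase i, |F i j| ≤ |F i i|

/-- A clustering set: `r > 0` nonempty, pairwise disjoint sets that cover `{1, …, n}`. -/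
structure IsClusteringSet {n r : ℕ} (I : Fin r → Finset (Fin n)) : Prop where
  r_pos : 0 < r
  nonempty : ∀ i, (I i).Nonempty
  disjoint : ∀ i k, i ≠ k → Disjoint (I i) (I k)
  cover : ∀ j, ∃ i, j ∈ I i

/-- The clustering-based projection matrix `P` with weight `w`. -/
def clusterProj {n r : ℕ} (w : Fin n → ℝ) (I : Fin r → Finset (Fin n)) :
    Matrix (Fin r) (Fin n) ℝ :=
  Matrix.of fun i j => if j ∈ I i then w j / √(∑ k ∈ I i, w k ^ 2) else 0

/-- The stacked projection `Π = I₄ ⊗ P`. -/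
def stackedProj {n r : ℕ} (w : Fin n → ℝ) (I : Fin r → Finset (Fin n)) :
    Matrix (Fin 4 × Fin r) (Fin 4 × Fin n) ℝ :=
  (1 : Matrix (Fin 4) (Fin 4) ℝ) ⊗ₖ clusterProj w I

section Riccati

variable {σ μ : Type*} [Fintype σ] [DecidableEq σ] [Fintype μ] [DecidableEq μ]

/-- All complex eigenvalues lie in the open left half plane. -/
def IsHurwitz (A : Matrix σ σ ℝ) : Prop :=
  ∀ z ∈ spectrum ℂ (A.map (algebraMap ℝ ℂ)), z.re < 0

/-- `AᵀX + XA + Q - XGX = 0` with `G = B R⁻¹ Bᵀ`. -/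
def SolvesARE (A : Matrix σ σ ℝ) (B : Matrix σ μ ℝ) (Q : Matrix σ σ ℝ) (R : Matrix μ μ ℝ)
    (X : Matrix σ σ ℝ) : Prop :=
  Aᵀ * X + X * A + Q - X * (B * R⁻¹ * Bᵀ) * X = 0

/-- `X` is a symmetric stabilizing solution of the ARE of the LQR problem `(A, B, Q, R)`. -/
def IsStabilizingSolution (A : Matrix σ σ ℝ) (B : Matrix σ μ ℝ) (Q : Matrix σ σ ℝ)
    (R : Matrix μ μ ℝ) (X : Matrix σ σ ℝ) : Prop :=
  X.IsSymm ∧ SolvesARE A B Q R X ∧ IsHurwitz (A - B * R⁻¹ * Bᵀ * X)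

/-- `w` can serve as the vector `w₀` in an eigenvalue decomposition
`A = [v₀ v₁] diag(0, Λ₁) [w₀ᵀ; w₁ᵀ]`, with `[w₀ᵀ; w₁ᵀ] = [v₀ v₁]⁻¹`: it is a left eigenvector for
the eigenvalue `0`, normalized against `v`. -/
def IsZeroModeDual (A : Matrix σ σ ℝ) (v w : σ → ℝ) : Prop :=
  w ᵥ* A = 0 ∧ w ⬝ᵥ v = 1

/-- `A_ε = A - ε v₀ w₀ᵀ`. -/
def shiftZeroMode (A : Matrix σ σ ℝ) (ε : ℝ) (v w : σ → ℝ) : Matrix σ σ ℝ :=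
  A - ε • vecMulVec v w

/-- `X = CPLQR(A, B, Q, R)`, computed with the shift `ε` of the zero mode `(v, w)`: `X ⪰ 0` is a
stabilizing solution of the ARE of `(A_ε, B, Q, R)`, and it is the only positive semidefinite
solution and the only symmetric stabilizing one. -/
structure IsCPLQR (A : Matrix σ σ ℝ) (B : Matrix σ μ ℝ) (Q : Matrix σ σ ℝ) (R : Matrix μ μ ℝ)
    (v w : σ → ℝ) (ε : ℝ) (X : Matrix σ σ ℝ) : Prop where
  posSemidef : X.PosSemidef
  stabilizing : IsStabilizingSolution (shiftZeroMode A ε v w) B Q R X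
  unique_posSemidef : ∀ Y : Matrix σ σ ℝ, Y.PosSemidef →
    SolvesARE (shiftZeroMode A ε v w) B Q R Y → Y = X
  unique_stabilizing : ∀ Y : Matrix σ σ ℝ,
    IsStabilizingSolution (shiftZeroMode A ε v w) B Q R Y → Y = X

end Riccati

namespace PowerSystem

variable {n r : ℕ} (S : PowerSystem n)

/-- `Ã = Π A Πᵀ`. -/
def redA (w : Fin n → ℝ) (I : Fin r → Finset (Fin n)) :
    Matrix (Fin 4 × Fin r) (Fin 4 × Fin r) ℝ :=
  stackedProj w I * S.A * (stackedProj w I)ᵀ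

/-- `B̃ = Π B`. -/
def redB (w : Fin n → ℝ) (I : Fin r → Finset (Fin n)) : Matrix (Fin 4 × Fin r) (Fin n) ℝ :=
  stackedProj w I * S.B

/-- `ṽ₀ = Π v₀`. -/
def redv₀ (w : Fin n → ℝ) (I : Fin r → Finset (Fin n)) : Fin 4 × Fin r → ℝ :=
  stackedProj w I *ᵥ S.v₀

/-- `K` results from the control inversion steps for the weight `w` and the clustering set `I`,
where the reduced problem `(Ã, B̃, Π Q Πᵀ, R)` is solved with the shift `ε` of the zero mode
`(ṽ₀, wt)` of `Ã`: `K = R⁻¹ Bᵀ X̂` with `X̂ = Πᵀ X̃ Π` and `X̃ = CPLQR(Ã, B̃, Q̃, R)`. -/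
def IsControlInversion (Q : Matrix (Fin 4 × Fin n) (Fin 4 × Fin n) ℝ)
    (R : Matrix (Fin n) (Fin n) ℝ) (w : Fin n → ℝ) (I : Fin r → Finset (Fin n))
    (ε : ℝ) (wt : Fin 4 × Fin r → ℝ) (K : Matrix (Fin n) (Fin 4 × Fin n) ℝ) : Prop :=
  ∃ X : Matrix (Fin 4 × Fin r) (Fin 4 × Fin r) ℝ,
    IsCPLQR (S.redA w I) (S.redB w I) (stackedProj w I * Q * (stackedProj w I)ᵀ) R
      (S.redv₀ w I) wt ε X ∧
    K = R⁻¹ * S.Bᵀ * ((stackedProj w I)ᵀ * X * stackedProj w I)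

end PowerSystem

end

/-! The projection is built from the weight `S.vbar`, so `Π` has orthonormal rows and `Πᵀṽ₀ = v₀`:
the consensus vector survives the reduction exactly. Zero row sums give `A v₀ = 0`, hence `Ã ṽ₀ =
0`, and the kernel of `Q̃` is exactly the span of `ṽ₀`. If the Riccati solution satisfies `X̃ ṽ₀ =
0`, then `K̂ v₀ = 0` and the lifted controller keeps the zero mode.

In `exists_isCPLQR`, evaluating the shifted equation at `ṽ₀` gives `2ε ṽ₀ᵀX̃ṽ₀ + (X̃ṽ₀)ᵀG(X̃ṽ₀) =
0`, so `X̃ṽ₀ = 0`. The shift then cancels from the equation: a solution for one pair `(ε, w̃₀)`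
solves it for all pairs. Existence is therefore needed for a single, conveniently large shift only.
Detectability holds for every shift, because the only undetected direction, `ṽ₀`, is moved to
eigenvalue `-ε`; it makes positive semidefinite solutions stabilizing, and stabilizing solutions are
unique.

Existence combines Bass' construction of a stabilizing gain from controllability with Kleinman's
monotone iteration; the Lyapunov theory underneath passes through the Cayley transform, whose powers
tend to zero. Controllability of the reduced pair (`PowerSystem.isControllable_red`) descends the
chain of state blocks, and its one nontrivial link is that the clustered `F₁` block is nonsingular.
That is a maximum-modulus argument from weak diagonal dominance, the sign condition and
nonsingularity of `F₁`. -/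

open Filter Topology

/-! ### Gelfand's formula and decay of powers -/

section BanachAlgebra

/-- Powers of an element with spectrum in the open unit disc tend to `0`. -/
theorem tendsto_pow_zero_of_spectrum_lt_one {𝔸 : Type*} [NormedRing 𝔸] [NormedAlgebra ℂ 𝔸]
    [CompleteSpace 𝔸] (a : 𝔸) (h : ∀ z ∈ spectrum ℂ a, ‖z‖ < 1) :
    Tendsto (fun k => a ^ k) atTop (𝓝 0) := by
  cases subsingleton_or_nontrivial 𝔸
  · simp [Subsingleton.elim _ (0 : 𝔸)]
  have h1 : spectralRadius ℂ a < (1 : NNReal) :=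
    spectrum.spectralRadius_lt_of_forall_lt a (r := 1) (fun k hk => by
      rw [← NNReal.coe_lt_coe]; simpa using h k hk)
  obtain ⟨r, hr1, hr2⟩ := ENNReal.lt_iff_exists_nnreal_btwn.1 h1
  have hr2' : r < 1 := by exact_mod_cast hr2
  have h2 := (spectrum.pow_nnnorm_pow_one_div_tendsto_nhds_spectralRadius a).eventually_lt_const hr1
  rw [tendsto_zero_iff_norm_tendsto_zero]
  refine squeeze_zero' (Eventually.of_forall fun k => norm_nonneg _) ?_
    (tendsto_pow_atTop_nhds_zero_of_lt_one r.2 hr2')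
  filter_upwards [h2, eventually_gt_atTop 0] with k hk hk0
  have hk0' : (0 : ℝ) < k := by exact_mod_cast hk0
  rw [one_div, ENNReal.rpow_inv_lt_iff hk0', ENNReal.rpow_natCast] at hk
  have : ‖a ^ k‖₊ < r ^ k := by exact_mod_cast hk
  exact_mod_cast this.le

end BanachAlgebra

/-! ### Real quadratic forms of symmetric matrices -/

section QuadraticForm

variable {σ : Type*} [Fintype σ]

/-- Symmetry of a product with a symmetric matrix, as a bilinear form. -/
theorem Matrix.IsSymm.dotProduct_mulVec_comm {X : Matrix σ σ ℝ} (hX : X.IsSymm) (a b : σ → ℝ) :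
    a ⬝ᵥ (X *ᵥ b) = b ⬝ᵥ (X *ᵥ a) := by
  rw [dotProduct_mulVec, ← mulVec_transpose, hX, dotProduct_comm]

theorem Matrix.PosSemidef.isSymm {σ : Type*} {X : Matrix σ σ ℝ} (hX : X.PosSemidef) : X.IsSymm := by
  have := hX.isHermitian
  rwa [IsHermitian, conjTranspose_eq_transpose_of_trivial] at this

theorem Matrix.PosSemidef.dotProduct_nonneg {X : Matrix σ σ ℝ} (hX : X.PosSemidef) (a : σ → ℝ) :
    0 ≤ a ⬝ᵥ (X *ᵥ a) := by
  simpa using hX.dotProduct_mulVec_nonneg a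

theorem Matrix.PosSemidef.mulVec_eq_zero {X : Matrix σ σ ℝ} (hX : X.PosSemidef) {a : σ → ℝ}
    (h : a ⬝ᵥ (X *ᵥ a) = 0) : X *ᵥ a = 0 :=
  (hX.dotProduct_mulVec_zero_iff a).1 (by simpa using h)

theorem Matrix.IsSymm.posSemidef {X : Matrix σ σ ℝ} (hX : X.IsSymm)
    (h : ∀ a : σ → ℝ, 0 ≤ a ⬝ᵥ (X *ᵥ a)) : X.PosSemidef := by
  refine .of_dotProduct_mulVec_nonneg ?_ (by simpa using h)
  rwa [IsHermitian, conjTranspose_eq_transpose_of_trivial]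

theorem Matrix.PosSemidef.transpose_mul_mul {τ : Type*} [Fintype τ] {X : Matrix σ σ ℝ}
    (hX : X.PosSemidef) (Y : Matrix σ τ ℝ) : (Yᵀ * X * Y).PosSemidef := by
  simpa using hX.conjTranspose_mul_mul_same Y

/-- The real quadratic form identity behind the Lyapunov eigenvalue estimate. -/
theorem lyapunov_form_eq {A X : Matrix σ σ ℝ} (hX : X.IsSymm) {α β : ℝ} {a b : σ → ℝ}
    (ha : A *ᵥ a = α • a - β • b) (hb : A *ᵥ b = β • a + α • b) :
    a ⬝ᵥ ((Aᵀ * X + X * A) *ᵥ a) + b ⬝ᵥ ((Aᵀ * X + X * A) *ᵥ b) =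
      2 * α * (a ⬝ᵥ (X *ᵥ a) + b ⬝ᵥ (X *ᵥ b)) := by
  simp only [add_mulVec, dotProduct_add, ← mulVec_mulVec]
  rw [dotProduct_mulVec a Aᵀ, vecMul_transpose, dotProduct_mulVec b Aᵀ, vecMul_transpose, ha, hb]
  simp only [mulVec_add, mulVec_sub, mulVec_smul, dotProduct_add, dotProduct_sub, add_dotProduct,
    sub_dotProduct, smul_dotProduct, dotProduct_smul, smul_eq_mul]
  rw [hX.dotProduct_mulVec_comm b a]
  ring

end QuadraticForm

/-! ### Lyapunov and Sylvester equations of Hurwitz matrices -/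

section Lyapunov

variable {σ : Type*} [Fintype σ] [DecidableEq σ]

/-- Spectral values of a complex matrix are its eigenvalues. -/
theorem mem_spectrum_iff_exists_mulVec {A : Matrix σ σ ℂ} {z : ℂ} :
    z ∈ spectrum ℂ A ↔ ∃ v ≠ 0, A *ᵥ v = z • v := by
  rw [spectrum.mem_iff, Matrix.isUnit_iff_isUnit_det, isUnit_iff_ne_zero, not_not,
    ← exists_mulVec_eq_zero_iff]
  refine exists_congr fun v => and_congr_right fun _ => ?_
  rw [sub_mulVec, sub_eq_zero, Algebra.algebraMap_eq_smul_one, smul_mulVec, one_mulVec, eq_comm]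

/-- Hurwitz matrices in terms of the real and imaginary parts of eigenvectors. -/
theorem isHurwitz_of_forall_re_im {A : Matrix σ σ ℝ}
    (h : ∀ (α β : ℝ) (a b : σ → ℝ), A *ᵥ a = α • a - β • b → A *ᵥ b = β • a + α • b →
      0 ≤ α → a = 0 ∧ b = 0) : IsHurwitz A := by
  intro z hz
  obtain ⟨v, hv0, hv⟩ := mem_spectrum_iff_exists_mulVec.1 hz
  by_contra hre
  push Not at hre
  have key := h z.re z.im (fun i => (v i).re) (fun i => (v i).im) (by
    ext i
    have := congrArg Complex.re (congrFun hv i)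
    simpa [mulVec, dotProduct, Complex.re_sum] using this) (by
    ext i
    have := congrArg Complex.im (congrFun hv i)
    simpa [mulVec, dotProduct, Complex.im_sum, add_comm] using this) hre
  exact hv0 (by ext i; exact Complex.ext (congrFun key.1 i) (congrFun key.2 i))

-- Stated entrywise, so that the operator norm used in the proof stays local.
attribute [local instance] Matrix.linftyOpNormedRing Matrix.linftyOpNormedAlgebra in
theorem tendsto_pow_apply_zero_of_spectrum_lt_one (C : Matrix σ σ ℂ)
    (h : ∀ z ∈ spectrum ℂ C, ‖z‖ < 1) (i j : σ) :
    Tendsto (fun k => (C ^ k) i j) atTop (𝓝 0) := by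
  have := tendsto_pow_zero_of_spectrum_lt_one C h
  exact ((continuous_id.matrix_elem i j).tendsto 0).comp this

/-- The Cayley transform of a Hurwitz matrix is power convergent to `0`. -/
theorem IsHurwitz.exists_cayley {A : Matrix σ σ ℝ} (hA : IsHurwitz A) :
    ∃ C : Matrix σ σ ℝ, IsUnit (1 - A) ∧ C * (1 - A) = 1 + A ∧
      Tendsto (fun k => C ^ k) atTop (𝓝 0) := by
  have hU : IsUnit (1 - A) := by
    rw [Matrix.isUnit_iff_isUnit_det, isUnit_iff_ne_zero]
    intro h0
    obtain ⟨v, hv0, hv⟩ := exists_mulVec_eq_zero_iff.2 h0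
    rw [sub_mulVec, one_mulVec, sub_eq_zero] at hv
    have : (1 : ℂ) ∈ spectrum ℂ (A.map (algebraMap ℝ ℂ)) := by
      refine mem_spectrum_iff_exists_mulVec.2 ⟨fun i => (v i : ℂ), ?_, ?_⟩
      · intro h; apply hv0; ext i; simpa using congrFun h i
      · ext i
        have := congrArg (algebraMap ℝ ℂ) (congrFun hv i)
        simpa [mulVec, dotProduct] using this.symm
    have := hA 1 this
    norm_num at this
  have hC : ((1 + A) * (1 - A)⁻¹) * (1 - A) = 1 + A := by
    rw [Matrix.mul_assoc, Matrix.nonsing_inv_mul _ ((Matrix.isUnit_iff_isUnit_det _).1 hU),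
      Matrix.mul_one]
  refine ⟨(1 + A) * (1 - A)⁻¹, hU, hC, ?_⟩
  set C := (1 + A) * (1 - A)⁻¹
  have hC2 : (1 - A) * C = 1 + A := by
    have hd := (Matrix.isUnit_iff_isUnit_det _).1 hU
    have : (1 - A) * (1 + A) = (1 + A) * (1 - A) := by noncomm_ring
    rw [← Matrix.mul_assoc, this, Matrix.mul_assoc, Matrix.mul_nonsing_inv _ hd, Matrix.mul_one]
  let f : Matrix σ σ ℝ →+* Matrix σ σ ℂ := (algebraMap ℝ ℂ).mapMatrix
  have hfC : (1 - f A) * f C = 1 + f A := by simpa using congrArg f hC2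
  -- An eigenvalue `z` of `C` comes from the eigenvalue `(z - 1)/(1 + z)` of `A`, whose real part
  -- has the sign of `|z|² - 1`.
  have key : ∀ z ∈ spectrum ℂ (f C), ‖z‖ < 1 := by
    intro z hz
    obtain ⟨v, hv0, hv⟩ := mem_spectrum_iff_exists_mulVec.1 hz
    have h1 : z • v - z • (f A *ᵥ v) = v + f A *ᵥ v := by
      have := congrArg (· *ᵥ v) hfC
      simpa [← mulVec_mulVec, hv, mulVec_smul, sub_mulVec, add_mulVec, smul_sub] using this
    have h2 : (1 + z) • (f A *ᵥ v) = (z - 1) • v := by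
      rw [add_smul, sub_smul, one_smul, one_smul]
      linear_combination (exp := 1) -h1
    have hz1 : 1 + z ≠ 0 := by
      intro h0
      have : z = -1 := by linear_combination h0
      rw [h0, zero_smul, this] at h2
      exact hv0 ((smul_eq_zero.1 h2.symm).resolve_left (by norm_num))
    have h3 : f A *ᵥ v = ((z - 1) / (1 + z)) • v := by
      rw [div_eq_inv_mul, ← smul_smul, ← h2, smul_smul, inv_mul_cancel₀ hz1, one_smul]
    have h4 := hA _ (mem_spectrum_iff_exists_mulVec.2 ⟨v, hv0, h3⟩)
    rw [Complex.div_re, ← add_div] at h4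
    have hpos : 0 < Complex.normSq (1 + z) := Complex.normSq_pos.2 hz1
    have h5 : (z - 1).re * (1 + z).re + (z - 1).im * (1 + z).im < 0 := by
      by_contra hcon
      push Not at hcon
      exact absurd h4 (not_lt.2 (div_nonneg hcon hpos.le))
    have h6 : ‖z‖ ^ 2 < 1 := by
      rw [Complex.sq_norm, Complex.normSq_apply]
      simp at h5
      nlinarith
    nlinarith [norm_nonneg z]
  refine tendsto_pi_nhds.2 fun i => tendsto_pi_nhds.2 fun j => ?_
  have h7 := tendsto_pow_apply_zero_of_spectrum_lt_one (f C) key i j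
  have h8 : ∀ k, (f C ^ k) i j = (((C ^ k) i j : ℝ) : ℂ) := fun k => by
    rw [← map_pow]; rfl
  simp only [h8] at h7
  exact (Complex.continuous_re.tendsto 0).comp h7

/-- The Sylvester equation `A₁ᵀX + XA₂ = 0` for Hurwitz `A₁`, `A₂` has only the zero solution. -/
theorem IsHurwitz.sylvester_eq_zero {A₁ A₂ X : Matrix σ σ ℝ} (h₁ : IsHurwitz A₁)
    (h₂ : IsHurwitz A₂) (h : A₁ᵀ * X + X * A₂ = 0) : X = 0 := by
  obtain ⟨C₁, hU₁, hC₁, ht₁⟩ := h₁.exists_cayley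
  obtain ⟨C₂, hU₂, hC₂, ht₂⟩ := h₂.exists_cayley
  -- The Cayley transform turns the Sylvester equation into a fixed-point equation, which can be
  -- iterated to the limit.
  have hX : C₁ᵀ * X * C₂ = X := by
    have hU₁' : IsUnit (1 - A₁)ᵀ := by
      rw [Matrix.isUnit_iff_isUnit_det, det_transpose, ← Matrix.isUnit_iff_isUnit_det]; exact hU₁
    apply hU₁'.mul_left_cancel
    apply hU₂.mul_right_cancel
    have e1 : (1 - A₁)ᵀ * C₁ᵀ = 1 + A₁ᵀ := by rw [← transpose_mul, hC₁]; simp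
    calc (1 - A₁)ᵀ * (C₁ᵀ * X * C₂) * (1 - A₂)
        = ((1 - A₁)ᵀ * C₁ᵀ) * X * (C₂ * (1 - A₂)) := by simp only [Matrix.mul_assoc]
      _ = (1 + A₁ᵀ) * X * (1 + A₂) := by rw [e1, hC₂]
      _ = (1 - A₁ᵀ) * X * (1 - A₂) + 2 • (A₁ᵀ * X + X * A₂) := by noncomm_ring
      _ = (1 - A₁)ᵀ * X * (1 - A₂) := by rw [h]; simp
  have hk : ∀ k, (C₁ ^ k)ᵀ * X * C₂ ^ k = X := by
    intro k
    induction k with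
    | zero => simp
    | succ k ih =>
      rw [pow_succ, pow_succ, transpose_mul]
      calc C₁ᵀ * (C₁ ^ k)ᵀ * X * (C₂ ^ k * C₂)
          = C₁ᵀ * ((C₁ ^ k)ᵀ * X * C₂ ^ k) * C₂ := by simp only [Matrix.mul_assoc]
        _ = X := by rw [ih, hX]
  have hlim : Tendsto (fun k => (C₁ ^ k)ᵀ * X * C₂ ^ k) atTop (𝓝 ((0 : Matrix σ σ ℝ)ᵀ * X * 0)) := by
    have ht : Tendsto (fun k => (C₁ ^ k)ᵀ) atTop (𝓝 (0 : Matrix σ σ ℝ)ᵀ) :=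
      (continuous_id.matrix_transpose.tendsto (0 : Matrix σ σ ℝ)).comp ht₁
    exact (ht.mul_const X).mul ht₂
  simp only [hk, Matrix.mul_zero] at hlim
  exact tendsto_nhds_unique tendsto_const_nhds hlim

/-- A symmetric solution of the Lyapunov equation of a Hurwitz matrix with positive semidefinite
right-hand side is positive semidefinite. -/
theorem IsHurwitz.posSemidef_of_lyapunov {A X Q : Matrix σ σ ℝ} (hA : IsHurwitz A)
    (hX : X.IsSymm) (hQ : Q.PosSemidef) (h : Aᵀ * X + X * A + Q = 0) : X.PosSemidef := by
  obtain ⟨C, hU, hC, ht⟩ := hA.exists_cayley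
  have hd := (Matrix.isUnit_iff_isUnit_det _).1 hU
  refine hX.posSemidef fun a => ?_
  -- With `x = (1 - A) y` one has `C x = (1 + A) y`, and the form of `X` drops from `x` to `C x` by
  -- exactly `2 yᵀQy`.
  have step : ∀ x : σ → ℝ, (C *ᵥ x) ⬝ᵥ (X *ᵥ (C *ᵥ x)) ≤ x ⬝ᵥ (X *ᵥ x) := by
    intro x
    obtain ⟨y, rfl⟩ : ∃ y, (1 - A) *ᵥ y = x :=
      ⟨(1 - A)⁻¹ *ᵥ x, by rw [mulVec_mulVec, Matrix.mul_nonsing_inv _ hd, one_mulVec]⟩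
    have hq := hQ.dotProduct_nonneg y
    have hy := congrArg (fun N : Matrix σ σ ℝ => y ⬝ᵥ (N *ᵥ y)) h
    simp only [add_mulVec, dotProduct_add, zero_mulVec, dotProduct_zero, ← mulVec_mulVec] at hy
    rw [dotProduct_mulVec y Aᵀ, vecMul_transpose, hX.dotProduct_mulVec_comm y] at hy
    rw [mulVec_mulVec, hC]
    simp only [add_mulVec, sub_mulVec, one_mulVec, mulVec_add, mulVec_sub, dotProduct_add,
      dotProduct_sub, add_dotProduct, sub_dotProduct]
    rw [hX.dotProduct_mulVec_comm y (A *ᵥ y)]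
    linarith
  have hk : ∀ k, ((C ^ k) *ᵥ a) ⬝ᵥ (X *ᵥ ((C ^ k) *ᵥ a)) ≤ a ⬝ᵥ (X *ᵥ a) := by
    intro k
    induction k with
    | zero => simp
    | succ k ih =>
      refine le_trans ?_ ih
      rw [pow_succ', ← mulVec_mulVec]
      exact step _
  have hlim : Tendsto (fun k => ((C ^ k) *ᵥ a) ⬝ᵥ (X *ᵥ ((C ^ k) *ᵥ a))) atTop
      (𝓝 (((0 : Matrix σ σ ℝ) *ᵥ a) ⬝ᵥ (X *ᵥ ((0 : Matrix σ σ ℝ) *ᵥ a)))) := by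
    have hc : Continuous fun N : Matrix σ σ ℝ => (N *ᵥ a) ⬝ᵥ (X *ᵥ (N *ᵥ a)) := by fun_prop
    exact (hc.tendsto 0).comp ht
  simp only [zero_mulVec, zero_dotProduct] at hlim
  exact le_of_tendsto hlim (Eventually.of_forall hk)

/-- The Lyapunov equation of a Hurwitz matrix is solvable. -/
theorem IsHurwitz.exists_lyapunov {A Q : Matrix σ σ ℝ} (hA : IsHurwitz A) (hQ : Q.PosSemidef) :
    ∃ X : Matrix σ σ ℝ, X.PosSemidef ∧ Aᵀ * X + X * A + Q = 0 := by
  let f : Matrix σ σ ℝ →ₗ[ℝ] Matrix σ σ ℝ :=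
    LinearMap.mulLeft ℝ Aᵀ + LinearMap.mulRight ℝ A
  have hf : ∀ X, f X = Aᵀ * X + X * A := fun X => rfl
  have hinj : Function.Injective f := by
    rw [← LinearMap.ker_eq_bot, LinearMap.ker_eq_bot']
    exact fun X hX => hA.sylvester_eq_zero hA hX
  obtain ⟨X, hX⟩ := LinearMap.injective_iff_surjective.1 hinj (-Q)
  have h : Aᵀ * X + X * A + Q = 0 := by rw [← hf, hX]; simp
  refine ⟨X, hA.posSemidef_of_lyapunov ?_ hQ h, h⟩
  -- Symmetry: `Xᵀ` solves the same equation.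
  apply hinj
  rw [hX, hf]
  have := congrArg transpose ((hf X).symm.trans hX)
  simpa [transpose_mul, hQ.isSymm.eq, add_comm] using this

end Lyapunov

/-! ### Riccati equations: detectability, Kleinman iteration, Bass' method -/

section Riccati

variable {σ : Type*} [Fintype σ]

/-- A crude bound from the absolute entries suffices: it only has to tell how large a multiple of
the identity, or of a rank-one shift, must be. -/
theorem exists_dotProduct_mulVec_ge (N : Matrix σ σ ℝ) :
    ∃ c : ℝ, 0 < c ∧ ∀ x : σ → ℝ, -c * (x ⬝ᵥ x) ≤ x ⬝ᵥ (N *ᵥ x) := by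
  refine ⟨1 + ∑ i, ∑ j, |N i j|, by positivity, fun x => ?_⟩
  have hx : 0 ≤ x ⬝ᵥ x := by simpa using dotProduct_star_self_nonneg x
  have hs : ∀ i, |x i| ^ 2 ≤ x ⬝ᵥ x := fun i => by
    rw [sq_abs, sq]
    exact Finset.single_le_sum (f := fun i => x i * x i) (fun i _ => mul_self_nonneg _)
      (Finset.mem_univ i)
  have h1 : -(x ⬝ᵥ (N *ᵥ x)) ≤ (∑ i, ∑ j, |N i j|) * (x ⬝ᵥ x) := by
    have e : -(x ⬝ᵥ (N *ᵥ x)) = ∑ i, ∑ j, -(x i * (N i j * x j)) := by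
      simp [dotProduct, mulVec, Finset.mul_sum]
    rw [e, Finset.sum_mul]
    refine Finset.sum_le_sum fun i _ => ?_
    rw [Finset.sum_mul]
    refine Finset.sum_le_sum fun j _ => ?_
    have h2 : |x i| * |x j| ≤ x ⬝ᵥ x := by nlinarith [hs i, hs j, sq_nonneg (|x i| - |x j|)]
    calc -(x i * (N i j * x j)) ≤ |x i * (N i j * x j)| := neg_le_abs _
      _ = |N i j| * (|x i| * |x j|) := by rw [abs_mul, abs_mul]; ring
      _ ≤ |N i j| * (x ⬝ᵥ x) := by gcongr
  nlinarith

/-- A decreasing sequence of positive semidefinite matrices converges to a positive semidefinite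
matrix. -/
theorem exists_tendsto_of_posSemidef_antitone [DecidableEq σ] {u : ℕ → Matrix σ σ ℝ}
    (h0 : ∀ k, (u k).PosSemidef) (h : ∀ k, (u k - u (k + 1)).PosSemidef) :
    ∃ L : Matrix σ σ ℝ, L.PosSemidef ∧ Tendsto u atTop (𝓝 L) := by
  have hq : ∀ x : σ → ℝ, ∃ l, Tendsto (fun k => x ⬝ᵥ (u k *ᵥ x)) atTop (𝓝 l) := by
    intro x
    refine ⟨_, tendsto_atTop_ciInf (antitone_nat_of_succ_le fun k => ?_)
      ⟨0, by rintro _ ⟨k, rfl⟩; exact (h0 k).dotProduct_nonneg x⟩⟩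
    have := (h k).dotProduct_nonneg x
    rw [sub_mulVec, dotProduct_sub] at this
    linarith
  choose q hq using hq
  -- Polarization recovers the entries from the convergent quadratic forms.
  have hent : ∀ i j k, u k i j = ((Pi.single i 1 + Pi.single j 1) ⬝ᵥ
      (u k *ᵥ (Pi.single i 1 + Pi.single j 1)) - Pi.single i 1 ⬝ᵥ (u k *ᵥ Pi.single i 1)
      - Pi.single j 1 ⬝ᵥ (u k *ᵥ Pi.single j 1)) / 2 := by
    intro i j k
    have hs : u k j i = u k i j := congrFun (congrFun (h0 k).isSymm i) j
    simp [mulVec_add, hs]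
    ring
  have hlim : ∃ L : Matrix σ σ ℝ, Tendsto u atTop (𝓝 L) := by
    refine ⟨fun i j => (q (Pi.single i 1 + Pi.single j 1) - q (Pi.single i 1)
      - q (Pi.single j 1)) / 2, tendsto_pi_nhds.2 fun i => tendsto_pi_nhds.2 fun j => ?_⟩
    simp only [hent i j]
    exact (((hq _).sub (hq _)).sub (hq _)).div_const 2
  obtain ⟨L, hL⟩ := hlim
  refine ⟨L, Matrix.IsSymm.posSemidef ?_ fun x => ?_, hL⟩
  · have ht : Tendsto (fun k => (u k)ᵀ) atTop (𝓝 Lᵀ) :=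
      (continuous_id.matrix_transpose.tendsto L).comp hL
    simp only [(h0 _).isSymm.eq] at ht
    exact tendsto_nhds_unique ht hL
  · have hc : Continuous fun N : Matrix σ σ ℝ => x ⬝ᵥ (N *ᵥ x) := by fun_prop
    exact ge_of_tendsto' ((hc.tendsto L).comp hL) fun k => (h0 k).dotProduct_nonneg x

/-- Detectability of `(Q, A)`: no eigenvector of `A` for an eigenvalue in the closed right half
plane is in the kernel of `Q`, in terms of real and imaginary parts. -/
def IsDetectable (A Q : Matrix σ σ ℝ) : Prop :=
  ∀ (α β : ℝ) (a b : σ → ℝ), A *ᵥ a = α • a - β • b → A *ᵥ b = β • a + α • b →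
    Q *ᵥ a = 0 → Q *ᵥ b = 0 → 0 ≤ α → a = 0 ∧ b = 0

/-- Controllability of `(A, G)`: the kernel of `G` contains no nonzero `Aᵀ`-invariant subspace. -/
def IsControllable {τ : Type*} (A : Matrix σ σ ℝ) (G : Matrix τ σ ℝ) : Prop :=
  ∀ W : Submodule ℝ (σ → ℝ), (∀ x ∈ W, Aᵀ *ᵥ x ∈ W) → (∀ x ∈ W, G *ᵥ x = 0) → W = ⊥

variable [DecidableEq σ]

/-- On an eigenvector with nonnegative real part, a sum of nonnegative terms vanishes, so each term
does. Feedback then acts as zero on it, leaving an eigenvector of `A` in the kernel of `Q`. The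
slack `W` covers both the Riccati equation (`W = 0`) and one Kleinman step. -/
theorem IsDetectable.isHurwitz {A G Q W X : Matrix σ σ ℝ} (hdet : IsDetectable A Q)
    (hG : G.PosSemidef) (hQ : Q.PosSemidef) (hW : W.PosSemidef) (hX : X.PosSemidef)
    (h : (A - G * X)ᵀ * X + X * (A - G * X) + Q + X * G * X + W = 0) :
    IsHurwitz (A - G * X) := by
  refine isHurwitz_of_forall_re_im fun α β a b ha hb hα => ?_
  have hform := lyapunov_form_eq hX.isSymm ha hb
  have hXG : ∀ x : σ → ℝ, x ⬝ᵥ ((X * G * X) *ᵥ x) = (X *ᵥ x) ⬝ᵥ (G *ᵥ (X *ᵥ x)) := fun x => by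
    rw [← mulVec_mulVec, ← mulVec_mulVec, hX.isSymm.dotProduct_mulVec_comm, dotProduct_comm]
  have hx : ∀ x : σ → ℝ, x ⬝ᵥ (((A - G * X)ᵀ * X + X * (A - G * X)) *ᵥ x) + x ⬝ᵥ (Q *ᵥ x)
      + (X *ᵥ x) ⬝ᵥ (G *ᵥ (X *ᵥ x)) + x ⬝ᵥ (W *ᵥ x) = 0 := fun x => by
    have := congrArg (fun N : Matrix σ σ ℝ => x ⬝ᵥ (N *ᵥ x)) h
    simp only [add_mulVec _ W, add_mulVec _ (X * G * X), add_mulVec _ Q, dotProduct_add, hXG,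
      zero_mulVec, dotProduct_zero] at this
    simpa only [add_mulVec, dotProduct_add] using this
  have hpos : 0 ≤ 2 * α * (a ⬝ᵥ (X *ᵥ a) + b ⬝ᵥ (X *ᵥ b)) :=
    mul_nonneg (by linarith) (add_nonneg (hX.dotProduct_nonneg a) (hX.dotProduct_nonneg b))
  have ea := hx a
  have eb := hx b
  have qa := hQ.dotProduct_nonneg a
  have qb := hQ.dotProduct_nonneg b
  have wa := hW.dotProduct_nonneg a
  have wb := hW.dotProduct_nonneg b
  have ga := hG.dotProduct_nonneg (X *ᵥ a)
  have gb := hG.dotProduct_nonneg (X *ᵥ b)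
  have Ga : G *ᵥ (X *ᵥ a) = 0 := hG.mulVec_eq_zero (by linarith)
  have Gb : G *ᵥ (X *ᵥ b) = 0 := hG.mulVec_eq_zero (by linarith)
  rw [sub_mulVec, ← mulVec_mulVec, Ga, sub_zero] at ha
  rw [sub_mulVec, ← mulVec_mulVec, Gb, sub_zero] at hb
  exact hdet α β a b ha hb (hQ.mulVec_eq_zero (by linarith)) (hQ.mulVec_eq_zero (by linarith)) hα

/-- A positive semidefinite solution of the Riccati equation of a detectable pair is
stabilizing. -/
theorem IsDetectable.isHurwitz_of_riccati {A G Q X : Matrix σ σ ℝ} (hdet : IsDetectable A Q)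
    (hG : G.PosSemidef) (hQ : Q.PosSemidef) (hX : X.PosSemidef)
    (h : Aᵀ * X + X * A + Q - X * G * X = 0) : IsHurwitz (A - G * X) := by
  refine hdet.isHurwitz hG hQ Matrix.PosSemidef.zero hX ?_
  refine Eq.trans ?_ h
  rw [transpose_sub, transpose_mul, hG.isSymm, hX.isSymm]
  noncomm_ring

/-- The difference of two solutions satisfies a homogeneous Sylvester equation with the two
closed-loop matrices as coefficients. -/
theorem riccati_stabilizing_unique {A G Q X Y : Matrix σ σ ℝ} (hG : G.IsSymm)
    (hX : X.IsSymm)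
    (hXe : Aᵀ * X + X * A + Q - X * G * X = 0) (hXs : IsHurwitz (A - G * X))
    (hYe : Aᵀ * Y + Y * A + Q - Y * G * Y = 0) (hYs : IsHurwitz (A - G * Y)) : X = Y := by
  rw [← sub_eq_zero]
  refine hXs.sylvester_eq_zero hYs ?_
  rw [transpose_sub, transpose_mul, hG, hX]
  calc _ = (Aᵀ * X + X * A + Q - X * G * X) - (Aᵀ * Y + Y * A + Q - Y * G * Y) := by noncomm_ring
    _ = 0 := by rw [hXe, hYe, sub_zero]

/-- Kleinman's iteration solves the Riccati equation from a stabilizing initial gain. -/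
theorem IsDetectable.exists_riccati {A G Q X₀ : Matrix σ σ ℝ} (hdet : IsDetectable A Q)
    (hG : G.PosSemidef) (hQ : Q.PosSemidef) (hX₀ : X₀.IsSymm) (h₀ : IsHurwitz (A - G * X₀)) :
    ∃ X : Matrix σ σ ℝ, X.PosSemidef ∧ Aᵀ * X + X * A + Q - X * G * X = 0 := by
  have step : ∀ X : Matrix σ σ ℝ, X.IsSymm ∧ IsHurwitz (A - G * X) → ∃ Y : Matrix σ σ ℝ,
      Y.PosSemidef ∧ IsHurwitz (A - G * Y) ∧
        (A - G * X)ᵀ * Y + Y * (A - G * X) + (Q + X * G * X) = 0 := by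
    rintro X ⟨hXs, hXh⟩
    have hXG : (X * G * X).PosSemidef := by
      have := hG.transpose_mul_mul X
      rwa [hXs] at this
    obtain ⟨Y, hY, hYe⟩ := hXh.exists_lyapunov (hQ.add hXG)
    refine ⟨Y, hY, ?_, hYe⟩
    -- Rewriting the Lyapunov equation around the new closed loop `A - G * Y` leaves the completed
    -- square `(X - Y) G (X - Y)`.
    refine hdet.isHurwitz hG hQ (hG.transpose_mul_mul (X - Y)) hY ?_
    rw [← hYe]
    simp only [transpose_sub, transpose_mul, hG.isSymm.eq, hY.isSymm.eq, hXs.eq]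
    noncomm_ring
  choose! f hfpos hfhur hfeq using step
  have hP : ∀ k, (f^[k] X₀).IsSymm ∧ IsHurwitz (A - G * f^[k] X₀) := by
    intro k
    induction k with
    | zero => exact ⟨hX₀, h₀⟩
    | succ k ih =>
      rw [Function.iterate_succ_apply']
      exact ⟨(hfpos _ ih).isSymm, hfhur _ ih⟩
  -- The sequence starts after one step: `X₀` need not be positive semidefinite, nor lie above its
  -- successor.
  set u : ℕ → Matrix σ σ ℝ := fun k => f^[k + 1] X₀ with hu
  have hu1 : ∀ k, u (k + 1) = f (u k) := fun k => Function.iterate_succ_apply' f (k + 1) X₀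
  have hupos : ∀ k, (u k).PosSemidef := fun k => by
    simp only [hu, Function.iterate_succ_apply']
    exact hfpos _ (hP k)
  have hueq : ∀ k, (A - G * u k)ᵀ * u (k + 1) + u (k + 1) * (A - G * u k) +
      (Q + u k * G * u k) = 0 := fun k => by
    rw [hu1]
    exact hfeq _ (hP (k + 1))
  have hmono : ∀ k, (u k - u (k + 1)).PosSemidef := by
    intro k
    have e0 : (A - G * f^[k] X₀)ᵀ * u k + u k * (A - G * f^[k] X₀) +
        (Q + f^[k] X₀ * G * f^[k] X₀) = 0 := by
      simp only [hu, Function.iterate_succ_apply']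
      exact hfeq _ (hP k)
    have e1 := hueq k
    -- Subtracting consecutive equations gives a Lyapunov equation for the decrement, again with a
    -- completed square as source.
    refine (hP (k + 1)).2.posSemidef_of_lyapunov
      ((hupos k).isSymm.sub (hupos (k + 1)).isSymm)
      (hG.transpose_mul_mul (f^[k] X₀ - u k)) ?_
    have hs := (hP k).1
    change (A - G * u k)ᵀ * _ + _ * (A - G * u k) + _ = 0
    generalize f^[k] X₀ = X at e0 hs ⊢
    refine Eq.trans ?_ ((congrArg₂ (· - ·) e0 e1).trans (sub_zero 0))
    simp only [transpose_sub, transpose_mul, hG.isSymm.eq, (hupos k).isSymm.eq, hs.eq]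
    noncomm_ring
  obtain ⟨L, hL, hlim⟩ := exists_tendsto_of_posSemidef_antitone hupos hmono
  refine ⟨L, hL, ?_⟩
  have hlim1 : Tendsto (fun k => u (k + 1)) atTop (𝓝 L) := hlim.comp (tendsto_add_atTop_nat 1)
  have hK : Tendsto (fun k => A - G * u k) atTop (𝓝 (A - G * L)) :=
    tendsto_const_nhds.sub (hlim.const_mul G)
  have hKt : Tendsto (fun k => (A - G * u k)ᵀ) atTop (𝓝 (A - G * L)ᵀ) :=
    (continuous_id.matrix_transpose.tendsto _).comp hK
  have hall := ((hKt.mul hlim1).add (hlim1.mul hK)).add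
    ((tendsto_const_nhds (x := Q)).add ((hlim.mul_const G).mul hlim))
  simp only [hueq] at hall
  have := tendsto_nhds_unique hall tendsto_const_nhds
  rw [← this, transpose_sub, transpose_mul, hG.isSymm, hL.isSymm]
  noncomm_ring

/-- Bass' method: a controllable pair has a stabilizing gain. -/
theorem IsControllable.exists_stabilizing {A G : Matrix σ σ ℝ} (hc : IsControllable A G)
    (hG : G.PosSemidef) : ∃ X : Matrix σ σ ℝ, X.IsSymm ∧ IsHurwitz (A - G * X) := by
  obtain ⟨β, hβ, hbound⟩ := exists_dotProduct_mulVec_ge Aᵀ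
  have hpos : ∀ x : σ → ℝ, 0 ≤ x ⬝ᵥ x := fun x => by simpa using dotProduct_star_self_nonneg x
  have hM : IsHurwitz (-(Aᵀ + (β + 1) • (1 : Matrix σ σ ℝ))) := by
    refine isHurwitz_of_forall_re_im fun α γ a b ha hb hα => ?_
    have h1 := congrArg (a ⬝ᵥ ·) ha
    have h2 := congrArg (b ⬝ᵥ ·) hb
    simp only [neg_mulVec, add_mulVec, smul_mulVec, one_mulVec, dotProduct_neg, dotProduct_add,
      dotProduct_sub, dotProduct_smul, smul_eq_mul] at h1 h2
    rw [dotProduct_comm b a] at h2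
    have h3 := hbound a
    have h4 := hbound b
    have h5 := mul_nonneg hα (hpos a)
    have h6 := mul_nonneg hα (hpos b)
    have h7 := hpos a
    have h8 := hpos b
    exact ⟨dotProduct_self_eq_zero.1 (by nlinarith), dotProduct_self_eq_zero.1 (by nlinarith)⟩
  -- With `c = β + 1` this reads `(A + c)Z + Z(Aᵀ + c) = 2G`. The kernel of `Z` is then
  -- `Aᵀ`-invariant and inside the kernel of `G`, so controllability makes `Z` invertible.
  obtain ⟨Z, hZ, hZe⟩ := hM.exists_lyapunov (hG.add hG)
  have hZx : ∀ x : σ → ℝ, Z *ᵥ (Aᵀ *ᵥ x) = G *ᵥ x + G *ᵥ x - (β + 1) • (Z *ᵥ x)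
      - (A *ᵥ (Z *ᵥ x) + (β + 1) • (Z *ᵥ x)) := fun x => by
    have := congrArg (· *ᵥ x) hZe
    simp only [transpose_neg, transpose_add, transpose_smul, transpose_transpose, transpose_one,
      add_mulVec, ← mulVec_mulVec, neg_mulVec, smul_mulVec, one_mulVec, mulVec_neg, mulVec_add,
      mulVec_smul, zero_mulVec] at this
    linear_combination -this
  have hGx : ∀ x : σ → ℝ, Z *ᵥ x = 0 → G *ᵥ x = 0 := fun x hx => by
    apply hG.mulVec_eq_zero
    have := congrArg (x ⬝ᵥ ·) (hZx x)
    simp only [hx, mulVec_zero, smul_zero, sub_zero, add_zero, dotProduct_add] at this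
    rw [hZ.isSymm.dotProduct_mulVec_comm, hx, dotProduct_zero] at this
    linarith
  have hker : LinearMap.ker (Matrix.toLin' Z) = ⊥ := by
    refine hc _ (fun x hx => ?_) (fun x hx => ?_)
    · rw [LinearMap.mem_ker, toLin'_apply] at hx ⊢
      rw [hZx, hx, hGx x hx]
      simp
    · exact hGx x (by simpa using hx)
  have hdet : IsUnit Z.det := by
    rw [isUnit_iff_ne_zero]
    intro h0
    obtain ⟨x, hx0, hx⟩ := exists_mulVec_eq_zero_iff.2 h0
    refine hx0 ?_
    have : x ∈ LinearMap.ker (Matrix.toLin' Z) := by simpa using hx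
    simpa [hker] using this
  refine ⟨Z⁻¹, hZ.inv.isSymm, isHurwitz_of_forall_re_im fun α γ a b ha hb hα => ?_⟩
  have hform := lyapunov_form_eq hZ.inv.isSymm ha hb
  -- Conjugating by `Z⁻¹` absorbs `2G` into the feedback: the form of `Z⁻¹` decays at rate `2(β +
  -- 1)`.
  have e : (A - G * Z⁻¹)ᵀ * Z⁻¹ + Z⁻¹ * (A - G * Z⁻¹) = (-(2 * (β + 1))) • Z⁻¹ := by
    have := congrArg (fun N => Z⁻¹ * N * Z⁻¹) hZe
    simp only [transpose_neg, transpose_add, transpose_smul, transpose_transpose, transpose_one,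
      Matrix.mul_add, Matrix.add_mul, Matrix.mul_neg, Matrix.neg_mul, Matrix.mul_assoc,
      Matrix.mul_nonsing_inv _ hdet, Matrix.mul_one, Matrix.smul_mul, Matrix.mul_smul,
      Matrix.one_mul, Matrix.mul_zero, Matrix.zero_mul] at this
    simp only [← Matrix.mul_assoc, Matrix.nonsing_inv_mul _ hdet, Matrix.one_mul] at this
    rw [transpose_sub, transpose_mul, hG.isSymm, hZ.inv.isSymm]
    simp only [Matrix.mul_sub, Matrix.sub_mul, ← Matrix.mul_assoc]
    refine sub_eq_zero.1 (Eq.trans ?_ (neg_eq_zero.2 this))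
    module
  rw [e] at hform
  simp only [smul_mulVec, dotProduct_smul, smul_eq_mul] at hform
  have na := hZ.inv.dotProduct_nonneg a
  have nb := hZ.inv.dotProduct_nonneg b
  have hs : a ⬝ᵥ (Z⁻¹ *ᵥ a) + b ⬝ᵥ (Z⁻¹ *ᵥ b) = 0 := by
    have h1 : (α + β + 1) * (a ⬝ᵥ (Z⁻¹ *ᵥ a) + b ⬝ᵥ (Z⁻¹ *ᵥ b)) = 0 := by linarith
    exact (mul_eq_zero.1 h1).resolve_left (by linarith)
  have inj : ∀ x : σ → ℝ, Z⁻¹ *ᵥ x = 0 → x = 0 := fun x hx => by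
    rw [← one_mulVec x, ← Matrix.mul_nonsing_inv _ hdet, ← mulVec_mulVec, hx, mulVec_zero]
  exact ⟨inj a (hZ.inv.mulVec_eq_zero (by linarith)), inj b (hZ.inv.mulVec_eq_zero (by linarith))⟩

end Riccati

/-! ### Shifting the zero mode -/

section ZeroMode

variable {σ μ : Type*} [Fintype σ] [Fintype μ] [DecidableEq μ]

theorem shiftZeroMode_mulVec (A : Matrix σ σ ℝ) (ε : ℝ) (v w x : σ → ℝ) :
    shiftZeroMode A ε v w *ᵥ x = A *ᵥ x - (ε * (w ⬝ᵥ x)) • v := by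
  ext i
  simp [shiftZeroMode, sub_mulVec, smul_mulVec, vecMulVec_mulVec]
  ring

theorem shiftZeroMode_transpose_mulVec (A : Matrix σ σ ℝ) (ε : ℝ) (v w x : σ → ℝ) :
    (shiftZeroMode A ε v w)ᵀ *ᵥ x = Aᵀ *ᵥ x - (ε * (v ⬝ᵥ x)) • w := by
  rw [← shiftZeroMode_mulVec]
  simp [shiftZeroMode, transpose_vecMulVec]

theorem Matrix.PosDef.posSemidef_mul_inv_mul_transpose {R : Matrix μ μ ℝ} (hR : R.PosDef)
    (B : Matrix σ μ ℝ) : (B * R⁻¹ * Bᵀ).PosSemidef := by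
  simpa using hR.inv.posSemidef.mul_mul_conjTranspose_same B

theorem Matrix.PosDef.transpose_mulVec_eq_zero {R : Matrix μ μ ℝ} (hR : R.PosDef)
    {B : Matrix σ μ ℝ} {x : σ → ℝ} (h : (B * R⁻¹ * Bᵀ) *ᵥ x = 0) : Bᵀ *ᵥ x = 0 := by
  have h1 : R⁻¹ *ᵥ (Bᵀ *ᵥ x) = 0 := by
    apply hR.inv.posSemidef.mulVec_eq_zero
    have := congrArg (x ⬝ᵥ ·) h
    simp only [← mulVec_mulVec, dotProduct_zero] at this
    rwa [dotProduct_mulVec, ← mulVec_transpose] at this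
  have hd : IsUnit R.det := (Matrix.isUnit_iff_isUnit_det R).1 hR.isUnit
  rw [← one_mulVec (Bᵀ *ᵥ x), ← Matrix.mul_nonsing_inv _ hd, ← mulVec_mulVec, h1, mulVec_zero]

/-- An undetected eigenvector has both parts in the span of `v`, where the shifted matrix acts as
`-ε`; a nonnegative real part is then impossible. -/
theorem isDetectable_shiftZeroMode {A Q : Matrix σ σ ℝ} {v w : σ → ℝ} {ε : ℝ} (hε : 0 < ε)
    (hv : A *ᵥ v = 0) (hw : IsZeroModeDual A v w)
    (hQ : ∀ x, Q *ᵥ x = 0 → ∃ c : ℝ, x = c • v) : IsDetectable (shiftZeroMode A ε v w) Q := by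
  intro α β a b ha hb hQa hQb hα
  obtain ⟨c, rfl⟩ := hQ a hQa
  obtain ⟨d, rfl⟩ := hQ b hQb
  have h1 := congrArg (w ⬝ᵥ ·) ha
  have h2 := congrArg (w ⬝ᵥ ·) hb
  simp only [shiftZeroMode_mulVec, mulVec_smul, hv, dotProduct_sub, dotProduct_add,
    dotProduct_smul, hw.2, smul_eq_mul, dotProduct_zero] at h1 h2
  have h3 : (α + ε) * (c ^ 2 + d ^ 2) = 0 := by linear_combination -c * h1 - d * h2
  have h4 : c ^ 2 + d ^ 2 = 0 := (mul_eq_zero.1 h3).resolve_left (by linarith)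
  have hc : c = 0 := by nlinarith [sq_nonneg c, sq_nonneg d]
  have hd : d = 0 := by nlinarith [sq_nonneg c, sq_nonneg d]
  simp [hc, hd]

/-- A sufficiently large shift of the zero mode keeps a controllable pair controllable. -/
theorem IsControllable.exists_shiftZeroMode {τ : Type*} {A : Matrix σ σ ℝ} {G : Matrix τ σ ℝ}
    (hc : IsControllable A G) {v w : σ → ℝ} (hv : A *ᵥ v = 0) (hw : IsZeroModeDual A v w) :
    ∃ ε : ℝ, 0 < ε ∧ IsControllable (shiftZeroMode A ε v w) G := by
  obtain ⟨β, hβ, hbound⟩ := exists_dotProduct_mulVec_ge Aᵀ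
  -- Chosen so that `-ε` is not an eigenvalue of `Aᵀ`.
  refine ⟨β + 1, by linarith, fun W hW hWG => ?_⟩
  set ε := β + 1 with hεdef
  have hvA : ∀ x, v ⬝ᵥ (Aᵀ *ᵥ x) = 0 := fun x => by
    rw [dotProduct_mulVec, vecMul_transpose, hv, zero_dotProduct]
  have hvw : v ⬝ᵥ w = 1 := by rw [dotProduct_comm, hw.2]
  have hAw : Aᵀ *ᵥ w = 0 := by rw [mulVec_transpose, hw.1]
  have hinj : ∀ x, Aᵀ *ᵥ x = -ε • x → x = 0 := fun x hx => by
    have h1 := hbound x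
    rw [hx, dotProduct_smul, smul_eq_mul, hεdef] at h1
    have h2 : 0 ≤ x ⬝ᵥ x := by simpa using dotProduct_star_self_nonneg x
    exact dotProduct_self_eq_zero.1 (by linarith)
  -- On the orthogonal complement of `v` the shift is invisible, so this part of `W` is
  -- `Aᵀ`-invariant.
  let W' : Submodule ℝ (σ → ℝ) :=
    { carrier := {x | x ∈ W ∧ v ⬝ᵥ x = 0}
      add_mem' := fun {x y} hx hy => ⟨W.add_mem hx.1 hy.1, by rw [dotProduct_add, hx.2, hy.2, add_zero]⟩
      zero_mem' := ⟨W.zero_mem, dotProduct_zero v⟩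
      smul_mem' := fun c x hx => ⟨W.smul_mem c hx.1, by rw [dotProduct_smul, hx.2, smul_zero]⟩ }
  have hW' : W' = ⊥ := by
    refine hc W' (fun x hx => ?_) (fun x hx => hWG x hx.1)
    refine ⟨?_, hvA x⟩
    have := hW x hx.1
    rwa [shiftZeroMode_transpose_mulVec, hx.2, mul_zero, zero_smul, sub_zero] at this
  have hall : ∀ x ∈ W, Aᵀ *ᵥ x = 0 := fun x hx => by
    -- Adding `ε • x` cancels the component along `v`. Membership in the trivial `W'` says that `x -
    -- (v ⬝ᵥ x) • w` solves `Aᵀ y = -ε y`, hence is zero.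
    have h1 : (shiftZeroMode A ε v w)ᵀ *ᵥ x + ε • x ∈ W' := by
      refine ⟨W.add_mem (hW x hx) (W.smul_mem _ hx), ?_⟩
      rw [shiftZeroMode_transpose_mulVec, dotProduct_add, dotProduct_sub, hvA, dotProduct_smul,
        dotProduct_smul, hvw]
      simp
    rw [hW', Submodule.mem_bot, shiftZeroMode_transpose_mulVec] at h1
    have h2 : x - (v ⬝ᵥ x) • w = 0 := by
      apply hinj
      rw [mulVec_sub, mulVec_smul, hAw, smul_zero, sub_zero, ← sub_eq_zero, ← h1]
      module
    rw [sub_eq_zero.1 h2, mulVec_smul, hAw, smul_zero]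
  exact hc W (fun x hx => by rw [hall x hx]; exact W.zero_mem) hWG

variable [DecidableEq σ]

/-- Well-posedness of the Riccati equation with shifted zero mode; the solution depends neither on
the shift nor on the dual vector, and it annihilates the zero mode. -/
theorem exists_isCPLQR {A Q : Matrix σ σ ℝ} {B : Matrix σ μ ℝ} {R : Matrix μ μ ℝ} {v : σ → ℝ}
    (hv : A *ᵥ v = 0) (hQ : Q.PosSemidef) (hQv : Q *ᵥ v = 0)
    (hQker : ∀ x, Q *ᵥ x = 0 → ∃ c : ℝ, x = c • v) (hR : R.PosDef) (hc : IsControllable A Bᵀ)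
    (hw : ∃ w, IsZeroModeDual A v w) :
    ∃ X : Matrix σ σ ℝ, X *ᵥ v = 0 ∧
      ∀ ε : ℝ, 0 < ε → ∀ w, IsZeroModeDual A v w → IsCPLQR A B Q R v w ε X := by
  obtain ⟨w₀, hw₀⟩ := hw
  have hG := hR.posSemidef_mul_inv_mul_transpose B
  obtain ⟨ε₀, hε₀, hc₀⟩ := hc.exists_shiftZeroMode hv hw₀
  have hcG : IsControllable (shiftZeroMode A ε₀ v w₀) (B * R⁻¹ * Bᵀ) :=
    fun W hW hWG => hc₀ W hW fun x hx => hR.transpose_mulVec_eq_zero (hWG x hx)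
  obtain ⟨X₀, hX₀, hX₀h⟩ := hcG.exists_stabilizing hG
  obtain ⟨X, hX, hXe⟩ := (isDetectable_shiftZeroMode hε₀ hv hw₀ hQker).exists_riccati hG hQ hX₀ hX₀h
  have hshift : ∀ ε w, IsZeroModeDual A v w → shiftZeroMode A ε v w *ᵥ v = -ε • v :=
    fun ε w h => by rw [shiftZeroMode_mulVec, hv, h.2]; simp
  have hXv : X *ᵥ v = 0 := by
    apply hX.mulVec_eq_zero
    generalize B * R⁻¹ * Bᵀ = G at hXe hG
    have h1 := congrArg (fun N : Matrix σ σ ℝ => v ⬝ᵥ (N *ᵥ v)) hXe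
    simp only [add_mulVec, sub_mulVec, ← mulVec_mulVec, hshift _ _ hw₀, hQv,
      dotProduct_add, dotProduct_sub, zero_mulVec, dotProduct_zero, mulVec_smul,
      dotProduct_smul, smul_eq_mul] at h1
    rw [dotProduct_mulVec v (shiftZeroMode A ε₀ v w₀)ᵀ, vecMul_transpose, hshift _ _ hw₀,
      smul_dotProduct, hX.isSymm.dotProduct_mulVec_comm v (G *ᵥ X *ᵥ v), dotProduct_comm (G *ᵥ X *ᵥ v),
      smul_eq_mul] at h1
    have h2 := hG.dotProduct_nonneg (X *ᵥ v)
    have h3 := hX.dotProduct_nonneg v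
    nlinarith
  -- The rank-one shift is killed by `X`, so the equation is the same for all `ε` and `w`.
  have hXshift : ∀ ε w, X * shiftZeroMode A ε v w = X * A := fun ε w => by
    rw [shiftZeroMode, Matrix.mul_sub, Matrix.mul_smul, mul_vecMulVec, hXv]
    simp
  have hXshift' : ∀ ε w, (shiftZeroMode A ε v w)ᵀ * X = Aᵀ * X := fun ε w => by
    have := congrArg transpose (hXshift ε w)
    rwa [transpose_mul, transpose_mul, hX.isSymm] at this
  refine ⟨X, hXv, fun ε hε w hw => ?_⟩
  have hdet := isDetectable_shiftZeroMode hε hv hw hQker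
  have hXe' : SolvesARE (shiftZeroMode A ε v w) B Q R X := by
    unfold SolvesARE
    rw [hXshift, hXshift', ← hXshift ε₀ w₀, ← hXshift' ε₀ w₀]
    exact hXe
  have hst := hdet.isHurwitz_of_riccati hG hQ hX hXe'
  have huniq : ∀ Y : Matrix σ σ ℝ,
      IsStabilizingSolution (shiftZeroMode A ε v w) B Q R Y → Y = X := fun Y hY =>
    riccati_stabilizing_unique hG.isSymm hY.1 hY.2.1 hY.2.2 hXe' hst
  exact ⟨hX, ⟨hX.isSymm, hXe', hst⟩, fun Y hY hYe =>
    huniq Y ⟨hY.isSymm, hYe, hdet.isHurwitz_of_riccati hG hQ hY hYe⟩, huniq⟩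

end ZeroMode

/-! ### Block matrix-vector products -/

section Blocks

variable {p q : Type*} [Fintype p] [Fintype q]

theorem comp_mulVec (N : Matrix p p (Matrix q q ℝ)) (x : p × q → ℝ) (a : p) :
    (fun i => (Matrix.comp p p q q ℝ N *ᵥ x) (a, i)) = ∑ b, N a b *ᵥ fun j => x (b, j) := by
  ext i
  rw [Finset.sum_apply]
  exact Fintype.sum_prod_type _

theorem transpose_comp_mulVec (N : Matrix p p (Matrix q q ℝ)) (x : p × q → ℝ) (b : p) :
    (fun j => ((Matrix.comp p p q q ℝ N)ᵀ *ᵥ x) (b, j)) =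
      ∑ a, (N a b)ᵀ *ᵥ fun i => x (a, i) := by
  ext j
  rw [Finset.sum_apply]
  exact Fintype.sum_prod_type _

end Blocks

/-! ### Cluster projections and aggregated diagonal dominance -/

section Clustering

variable {n r : ℕ} {I : Fin r → Finset (Fin n)}

theorem IsClusteringSet.eq_of_mem (hI : IsClusteringSet I) {i k : Fin r} {j : Fin n}
    (hi : j ∈ I i) (hk : j ∈ I k) : i = k := by
  by_contra h
  exact Finset.disjoint_left.1 (hI.disjoint i k h) hi hk

/-- Aggregation over clusters of a nonsingular diagonally dominant matrix with nonnegative diagonal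
is injective. -/
theorem IsDiagDominant.eq_zero_of_cluster_of_nonneg {F : Matrix (Fin n) (Fin n) ℝ}
    (hF : IsDiagDominant F) (hpos : ∀ i, 0 ≤ F i i) (hdet : IsUnit F.det) (hI : IsClusteringSet I)
    {x : Fin n → ℝ} (hconst : ∀ i, ∀ a ∈ I i, ∀ b ∈ I i, x a = x b)
    (hsum : ∀ i, ∑ a ∈ I i, (F *ᵥ x) a = 0) : x = 0 := by
  classical
  by_contra hx
  obtain ⟨j₀, hj₀⟩ : ∃ j, x j ≠ 0 := Function.ne_iff.1 hx
  obtain ⟨a₀, -, ha₀⟩ := Finset.exists_max_image Finset.univ (fun j => |x j|) ⟨j₀, Finset.mem_univ _⟩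
  set m := |x a₀| with hm
  have hmax : ∀ j, |x j| ≤ m := fun j => ha₀ j (Finset.mem_univ j)
  have hm0 : 0 < m := lt_of_lt_of_le (abs_pos.2 hj₀) (hmax j₀)
  have hterm : ∀ a b, 0 ≤ |F a b| * (m * (m - |x b|)) := fun a b =>
    mul_nonneg (abs_nonneg _) (mul_nonneg hm0.le (sub_nonneg.2 (hmax b)))
  -- Dominance in a row where `|x|` is maximal: the right side exceeds the left by a nonnegative
  -- amount, so it is itself nonnegative.
  have hrow : ∀ a, |x a| = m →
      ∑ b ∈ Finset.univ.erase a, |F a b| * (m * (m - |x b|)) ≤ x a * (F *ᵥ x) a := by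
    intro a ha
    have hsq : x a * x a = m * m := by rw [← ha, abs_mul_abs_self]
    have h1 : x a * (F *ᵥ x) a = F a a * (m * m) +
        ∑ b ∈ Finset.univ.erase a, x a * (F a b * x b) := by
      rw [mulVec, dotProduct, Finset.mul_sum, ← Finset.add_sum_erase _ _ (Finset.mem_univ a)]
      linear_combination F a a * hsq
    have h2 : (∑ b ∈ Finset.univ.erase a, |F a b|) * (m * m) ≤ F a a * (m * m) := by
      have := hF a
      rw [abs_of_nonneg (hpos a)] at this
      exact mul_le_mul_of_nonneg_right this (by positivity)
    have h3 : ∑ b ∈ Finset.univ.erase a, |F a b| * (m * (m - |x b|)) ≤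
        (∑ b ∈ Finset.univ.erase a, |F a b|) * (m * m) +
          ∑ b ∈ Finset.univ.erase a, x a * (F a b * x b) := by
      rw [Finset.sum_mul, ← Finset.sum_add_distrib]
      refine Finset.sum_le_sum fun b _ => ?_
      have h4 := neg_abs_le (x a * (F a b * x b))
      rw [abs_mul, abs_mul, ha] at h4
      linarith
    linarith
  have hnonneg : ∀ a, |x a| = m → 0 ≤ x a * (F *ᵥ x) a := fun a ha =>
    (Finset.sum_nonneg fun b _ => hterm a b).trans (hrow a ha)
  -- As `x` is constant on a cluster, a cluster meeting the maximal set lies inside it; its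
  -- nonnegative terms sum to zero.
  have hzero : ∀ a, |x a| = m → x a * (F *ᵥ x) a = 0 := by
    intro a ha
    obtain ⟨i, hi⟩ := hI.cover a
    have h1 : ∑ b ∈ I i, x b * (F *ᵥ x) b = 0 := by
      rw [Finset.sum_congr rfl fun b hb => by rw [hconst i b hb a hi], ← Finset.mul_sum, hsum,
        mul_zero]
    exact (Finset.sum_eq_zero_iff_of_nonneg fun b hb =>
      hnonneg b (by rw [hconst i b hb a hi, ha])).1 h1 a hi
  have hFx : ∀ a, |x a| = m → (F *ᵥ x) a = 0 := fun a ha =>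
    (mul_eq_zero.1 (hzero a ha)).resolve_left fun h => by
      rw [h, abs_zero] at ha
      exact hm0.ne ha
  have hFab : ∀ a b, |x a| = m → |x b| ≠ m → F a b = 0 := by
    intro a b ha hb
    have hab : b ∈ Finset.univ.erase a :=
      Finset.mem_erase.2 ⟨fun h => hb (h ▸ ha), Finset.mem_univ b⟩
    have h1 : ∑ b ∈ Finset.univ.erase a, |F a b| * (m * (m - |x b|)) = 0 :=
      le_antisymm ((hrow a ha).trans (hzero a ha).le) (Finset.sum_nonneg fun b _ => hterm a b)
    have h2 := (Finset.sum_eq_zero_iff_of_nonneg fun b _ => hterm a b).1 h1 b hab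
    rcases mul_eq_zero.1 h2 with h3 | h3
    · exact abs_eq_zero.1 h3
    · rcases mul_eq_zero.1 h3 with h4 | h4
      · exact absurd h4 hm0.ne'
      · exact absurd (sub_eq_zero.1 h4).symm hb
  -- The rows of the maximal set vanish outside it. Keeping them and putting identity rows elsewhere
  -- isolates the diagonal block, which annihilates the restriction of `x`. A left null vector of
  -- `H` is supported on the maximal set, where `H` and `F` share rows, so it also annihilates `F`.
  let H : Matrix (Fin n) (Fin n) ℝ := Matrix.of fun a b =>
    if |x a| = m then F a b else (1 : Matrix (Fin n) (Fin n) ℝ) a b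
  have hHdet : H.det = 0 := by
    let z : Fin n → ℝ := fun a => if |x a| = m then x a else 0
    refine exists_mulVec_eq_zero_iff.1 ⟨z, fun h => ?_, ?_⟩
    · have := congrFun h a₀
      simp only [z, ← hm, if_true, Pi.zero_apply] at this
      rw [hm, this, abs_zero] at hm0
      exact hm0.false
    · ext a
      by_cases ha : |x a| = m
      · have : (F *ᵥ z) a = (F *ᵥ x) a := by
          simp only [mulVec, dotProduct, z]
          refine Finset.sum_congr rfl fun b _ => ?_
          by_cases hb : |x b| = m
          · rw [if_pos hb]
          · rw [hFab a b ha hb, zero_mul, zero_mul]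
        rw [hFx a ha] at this
        simpa [H, mulVec, dotProduct, ha] using this
      · change ∑ b, H a b * z b = 0
        simp only [H, of_apply, if_neg ha]
        exact (congrFun (one_mulVec z) a).trans (if_neg ha)
  obtain ⟨u, hu0, hu⟩ := exists_vecMul_eq_zero_iff.2 hHdet
  have huH : ∀ b, ∑ a, u a * H a b = 0 := fun b => congrFun hu b
  have husupp : ∀ b, |x b| ≠ m → u b = 0 := by
    intro b hb
    rw [← huH b, Finset.sum_eq_single b]
    · simp [H, hb]
    · intro a _ hab
      by_cases ha : |x a| = m
      · simp [H, ha, hFab a b ha hb]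
      · simp [H, ha, hab]
    · simp
  refine hdet.ne_zero (exists_vecMul_eq_zero_iff.1 ⟨u, hu0, ?_⟩)
  ext b
  rw [Pi.zero_apply, ← huH b]
  change ∑ a, u a * F a b = ∑ a, u a * H a b
  refine Finset.sum_congr rfl fun a _ => ?_
  by_cases ha : |x a| = m
  · simp [H, ha]
  · rw [husupp a ha, zero_mul, zero_mul]

theorem IsDiagDominant.eq_zero_of_cluster {F : Matrix (Fin n) (Fin n) ℝ}
    (hF : IsDiagDominant F) (hsign : (∀ i, 0 ≤ F i i) ∨ (∀ i, F i i ≤ 0)) (hdet : IsUnit F.det)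
    (hI : IsClusteringSet I) {x : Fin n → ℝ} (hconst : ∀ i, ∀ a ∈ I i, ∀ b ∈ I i, x a = x b)
    (hsum : ∀ i, ∑ a ∈ I i, (F *ᵥ x) a = 0) : x = 0 := by
  rcases hsign with h | h
  · exact hF.eq_zero_of_cluster_of_nonneg h hdet hI hconst hsum
  · have hF' : IsDiagDominant (-F) := fun i => by simpa using hF i
    refine hF'.eq_zero_of_cluster_of_nonneg (fun i => by simpa using h i) ?_ hI hconst fun i => ?_
    · rw [isUnit_iff_ne_zero, det_neg]
      exact mul_ne_zero (by simp) hdet.ne_zero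
    · simp [neg_mulVec, hsum i]

variable {w : Fin n → ℝ}

theorem IsClusteringSet.norm_pos (hI : IsClusteringSet I) (hw : ∀ j, 0 < w j) (i : Fin r) :
    0 < √(∑ k ∈ I i, w k ^ 2) :=
  Real.sqrt_pos.2 (Finset.sum_pos (fun j _ => pow_pos (hw j) 2) (hI.nonempty i))

theorem clusterProj_mulVec (y : Fin n → ℝ) (i : Fin r) :
    (clusterProj w I *ᵥ y) i = ∑ j ∈ I i, w j / √(∑ k ∈ I i, w k ^ 2) * y j := by
  simp [clusterProj, mulVec, dotProduct, ite_mul, Finset.sum_ite_mem]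

theorem IsClusteringSet.transpose_clusterProj_mulVec (hI : IsClusteringSet I) (y : Fin r → ℝ)
    {i : Fin r} {j : Fin n} (hj : j ∈ I i) :
    ((clusterProj w I)ᵀ *ᵥ y) j = w j / √(∑ k ∈ I i, w k ^ 2) * y i := by
  rw [mulVec, dotProduct, Finset.sum_eq_single i]
  · simp [clusterProj, hj]
  · intro k _ hk
    have : j ∉ I k := fun h => hk (hI.eq_of_mem h hj)
    simp [clusterProj, this]
  · simp

theorem IsClusteringSet.clusterProj_mulVec_transpose (hI : IsClusteringSet I) (hw : ∀ j, 0 < w j)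
    (y : Fin r → ℝ) : clusterProj w I *ᵥ ((clusterProj w I)ᵀ *ᵥ y) = y := by
  ext i
  have hn := hI.norm_pos hw i
  rw [clusterProj_mulVec, Finset.sum_congr rfl fun j hj => by
    rw [hI.transpose_clusterProj_mulVec y hj]]
  have hs : √(∑ k ∈ I i, w k ^ 2) ^ 2 = ∑ k ∈ I i, w k ^ 2 := Real.sq_sqrt (by positivity)
  calc _ = (∑ j ∈ I i, w j ^ 2) / √(∑ k ∈ I i, w k ^ 2) ^ 2 * y i := by
        rw [Finset.sum_div, Finset.sum_mul]
        exact Finset.sum_congr rfl fun j _ => by ring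
    _ = y i := by rw [hs, div_self (hs ▸ (pow_pos hn 2).ne'), one_mul]

/-- Within a cluster the row of `P` is the normalized weight, so `w` lies in the range of the
orthogonal projection `PᵀP`. -/
theorem IsClusteringSet.transpose_clusterProj_mulVec_self (hI : IsClusteringSet I)
    (hw : ∀ j, 0 < w j) : (clusterProj w I)ᵀ *ᵥ (clusterProj w I *ᵥ w) = w := by
  ext j
  obtain ⟨i, hi⟩ := hI.cover j
  have hn := hI.norm_pos hw i
  have hs : √(∑ k ∈ I i, w k ^ 2) ^ 2 = ∑ k ∈ I i, w k ^ 2 := Real.sq_sqrt (by positivity)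
  have h1 : ∑ k ∈ I i, w k / √(∑ k ∈ I i, w k ^ 2) * w k = √(∑ k ∈ I i, w k ^ 2) := by
    rw [eq_comm, ← mul_right_inj' hn.ne', ← sq, hs, Finset.mul_sum]
    exact Finset.sum_congr rfl fun k _ => by rw [hs.symm] at *; field_simp
  rw [hI.transpose_clusterProj_mulVec _ hi, clusterProj_mulVec, h1]
  field_simp

theorem stackedProj_mulVec (y : Fin 4 × Fin n → ℝ) (a : Fin 4) (i : Fin r) :
    (stackedProj w I *ᵥ y) (a, i) = (clusterProj w I *ᵥ fun j => y (a, j)) i := by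
  simp [stackedProj, mulVec, dotProduct, Fintype.sum_prod_type, one_apply]

theorem transpose_stackedProj_mulVec (y : Fin 4 × Fin r → ℝ) (a : Fin 4) (j : Fin n) :
    ((stackedProj w I)ᵀ *ᵥ y) (a, j) = ((clusterProj w I)ᵀ *ᵥ fun i => y (a, i)) j := by
  simp [stackedProj, mulVec, dotProduct, Fintype.sum_prod_type, one_apply]

theorem IsClusteringSet.stackedProj_mulVec_transpose (hI : IsClusteringSet I) (hw : ∀ j, 0 < w j)
    (y : Fin 4 × Fin r → ℝ) : stackedProj w I *ᵥ ((stackedProj w I)ᵀ *ᵥ y) = y := by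
  ext ⟨a, i⟩
  simp only [stackedProj_mulVec, transpose_stackedProj_mulVec]
  exact congrFun (hI.clusterProj_mulVec_transpose hw _) i

end Clustering

/-! ### The power network: zero mode and reduced controllability -/

namespace PowerSystem

variable {n r : ℕ} (S : PowerSystem n) {I : Fin r → Finset (Fin n)}

theorem sqrt_trace_pos (j : Fin n) : 0 < √(∑ k, S.M k) :=
  Real.sqrt_pos.2 (Finset.sum_pos (fun k _ => S.M_pos k) ⟨j, Finset.mem_univ j⟩)

theorem vbar_pos (j : Fin n) : 0 < S.vbar j :=
  div_pos (Real.sqrt_pos.2 (S.M_pos j)) (S.sqrt_trace_pos j)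

theorem invSqrtM_mulVec (x : Fin n → ℝ) (j : Fin n) :
    (S.invSqrtM *ᵥ x) j = (√(S.M j))⁻¹ * x j := by
  simp [invSqrtM, mulVec_diagonal]

/-- Undoing the mass scaling turns `S.vbar` into a constant vector. -/
theorem mulVec_invSqrtM_vbar {L : Matrix (Fin n) (Fin n) ℝ} (hL : ∀ i, ∑ j, L i j = 0) :
    L *ᵥ (S.invSqrtM *ᵥ S.vbar) = 0 := by
  have h : S.invSqrtM *ᵥ S.vbar = fun _ => (√(∑ k, S.M k))⁻¹ := by
    ext j
    have := (Real.sqrt_pos.2 (S.M_pos j)).ne'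
    rw [invSqrtM_mulVec, vbar]
    field_simp
  ext i
  rw [h, mulVec, dotProduct, ← Finset.sum_mul, hL, zero_mul, Pi.zero_apply]

theorem A_mulVec_v₀ : S.A *ᵥ S.v₀ = 0 := by
  have h : ∀ a : Fin 4, (fun b => if b = 0 then S.vbar else 0 : Fin 4 → Fin n → ℝ) a =
      fun j => S.v₀ (a, j) := fun a => by
    by_cases ha : a = 0 <;> ext j <;> simp [v₀, ha]
  ext ⟨a, i⟩
  refine (congrFun (comp_mulVec _ S.v₀ a) i).trans ?_
  rw [Fin.sum_univ_four, ← h 0, ← h 1, ← h 2, ← h 3]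
  simp only [if_true, Fin.reduceEq, if_false, mulVec_zero, add_zero]
  fin_cases a
  · change ((0 : Matrix (Fin n) (Fin n) ℝ) *ᵥ S.vbar) i = 0
    simp
  · change (S.L₁m *ᵥ S.vbar) i = 0
    simp [L₁m, ← mulVec_mulVec, S.mulVec_invSqrtM_vbar S.L₁_rowSum]
  · change (S.L₂m *ᵥ S.vbar) i = 0
    simp [L₂m, ← mulVec_mulVec, S.mulVec_invSqrtM_vbar S.L₂_rowSum]
  · change (S.L₃m *ᵥ S.vbar) i = 0
    simp [L₃m, ← mulVec_mulVec, S.mulVec_invSqrtM_vbar S.L₃_rowSum]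

theorem A_transpose_mulVec_one (x : Fin 4 × Fin n → ℝ) :
    (fun j => (S.Aᵀ *ᵥ x) (1, j)) = (fun j => x (0, j)) - S.Dmᵀ *ᵥ fun j => x (1, j) := by
  refine (transpose_comp_mulVec _ x 1).trans ?_
  rw [Fin.sum_univ_four]
  change 1ᵀ *ᵥ _ + (-S.Dm)ᵀ *ᵥ _ + 0ᵀ *ᵥ _ + 0ᵀ *ᵥ _ = _
  rw [transpose_one, transpose_zero, transpose_neg, neg_mulVec, one_mulVec, zero_mulVec,
    zero_mulVec, add_zero, add_zero, sub_eq_add_neg]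

theorem A_transpose_mulVec_two (x : Fin 4 × Fin n → ℝ) :
    (fun j => (S.Aᵀ *ᵥ x) (2, j)) = (S.F₁mᵀ *ᵥ fun j => x (1, j)) +
      (S.F₂mᵀ *ᵥ fun j => x (2, j)) + S.F₃mᵀ *ᵥ fun j => x (3, j) := by
  refine (transpose_comp_mulVec _ x 2).trans ?_
  rw [Fin.sum_univ_four]
  change 0ᵀ *ᵥ _ + S.F₁mᵀ *ᵥ _ + S.F₂mᵀ *ᵥ _ + S.F₃mᵀ *ᵥ _ = _
  rw [transpose_zero, zero_mulVec, zero_add]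

theorem A_transpose_mulVec_three (x : Fin 4 × Fin n → ℝ) :
    (fun j => (S.Aᵀ *ᵥ x) (3, j)) = (fun j => x (2, j)) - fun j => x (3, j) := by
  refine (transpose_comp_mulVec _ x 3).trans ?_
  rw [Fin.sum_univ_four]
  change 0ᵀ *ᵥ _ + 0ᵀ *ᵥ _ + 1ᵀ *ᵥ _ + (-1)ᵀ *ᵥ _ = _
  rw [transpose_one, transpose_zero, transpose_neg, transpose_one, neg_mulVec, one_mulVec,
    one_mulVec, zero_mulVec, zero_mulVec, zero_add, zero_add, sub_eq_add_neg]

theorem eq_zero_of_B_transpose_mulVec {x : Fin 4 × Fin n → ℝ} (h : S.Bᵀ *ᵥ x = 0) :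
    (fun j => x (3, j)) = 0 := by
  ext j
  have := congrFun h j
  have h1 := (Real.sqrt_pos.2 (S.M_pos j)).ne'
  have h2 := (S.TA_pos j).ne'
  simpa [B, B₁, sqrtM, invTA, mulVec, dotProduct, Fintype.sum_prod_type, Fin.sum_univ_four,
    diagonal_apply, h1, h2] using this

/-- With weight `S.vbar`, the vector `M^{-1/2}Pᵀz` is constant on clusters and `P M^{-1/2}` sums
over clusters up to positive factors, so the clustered dominance lemma applies to `F₁`. The
determinant transfers this to the transpose, which controllability uses. -/
theorem redF₁m_injective (hF_dom : IsDiagDominant S.F₁)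
    (hF_sign : (∀ i, 0 ≤ S.F₁ i i) ∨ (∀ i, S.F₁ i i ≤ 0)) (hF_det : IsUnit S.F₁.det)
    (hI : IsClusteringSet I) {y : Fin r → ℝ}
    (hy : (clusterProj S.vbar I * S.F₁mᵀ * (clusterProj S.vbar I)ᵀ) *ᵥ y = 0) : y = 0 := by
  set P := clusterProj S.vbar I with hP
  have hdet : (P * S.F₁m * Pᵀ).det ≠ 0 := by
    intro h0
    obtain ⟨z, hz0, hz⟩ := exists_mulVec_eq_zero_iff.2 h0
    apply hz0
    have hMne : ∀ j, √(S.M j) ≠ 0 := fun j => (Real.sqrt_pos.2 (S.M_pos j)).ne'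
    have hx : ∀ i, ∀ j ∈ I i, (S.invSqrtM *ᵥ (Pᵀ *ᵥ z)) j =
        (√(∑ k, S.M k) * √(∑ k ∈ I i, S.vbar k ^ 2))⁻¹ * z i := by
      intro i j hj
      have := hMne j
      rw [invSqrtM_mulVec, hI.transpose_clusterProj_mulVec z hj]
      conv_lhs => enter [2, 1, 1]; rw [vbar]
      field_simp
    have hx0 : S.invSqrtM *ᵥ (Pᵀ *ᵥ z) = 0 := by
      refine hF_dom.eq_zero_of_cluster hF_sign hF_det hI
        (fun i a ha b hb => by rw [hx i a ha, hx i b hb]) fun i => ?_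
      have h1 := congrFun hz i
      simp only [F₁m, ← mulVec_mulVec] at h1
      rw [hP, clusterProj_mulVec, ← hP] at h1
      obtain ⟨j, -⟩ := hI.nonempty i
      have hc := (mul_pos (S.sqrt_trace_pos j) (hI.norm_pos S.vbar_pos i)).ne'
      have h2 : (√(∑ k, S.M k) * √(∑ k ∈ I i, S.vbar k ^ 2))⁻¹ *
          ∑ a ∈ I i, (S.F₁ *ᵥ (S.invSqrtM *ᵥ (Pᵀ *ᵥ z))) a = 0 := by
        rw [Finset.mul_sum]
        refine Eq.trans (Finset.sum_congr rfl fun a _ => ?_) h1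
        have := hMne a
        rw [invSqrtM_mulVec]
        conv_rhs => enter [1, 1]; rw [vbar]
        field_simp
      exact (mul_eq_zero.1 h2).resolve_left (inv_ne_zero hc)
    ext i
    obtain ⟨j, hj⟩ := hI.nonempty i
    have hc := (mul_pos (S.sqrt_trace_pos j) (hI.norm_pos S.vbar_pos i)).ne'
    have h1 := hx i j hj
    rw [hx0, Pi.zero_apply, eq_comm] at h1
    exact (mul_eq_zero.1 h1).resolve_left (inv_ne_zero hc)
  by_contra hy0
  refine hdet ?_
  rw [← det_transpose]
  refine exists_mulVec_eq_zero_iff.1 ⟨y, hy0, ?_⟩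
  rwa [transpose_mul, transpose_mul, transpose_transpose, ← Matrix.mul_assoc]

/-- Invertibility of `B₁` kills block 3; invariance then kills block 2 through the identity block,
block 1 through `F₁m`, and block 0 through the identity above it. The blocks built from `L₁`, `L₂`,
`L₃` never enter. -/
theorem isControllable_red (hF_dom : IsDiagDominant S.F₁)
    (hF_sign : (∀ i, 0 ≤ S.F₁ i i) ∨ (∀ i, S.F₁ i i ≤ 0)) (hF_det : IsUnit S.F₁.det)
    (hI : IsClusteringSet I) : IsControllable (S.redA S.vbar I) (S.redB S.vbar I)ᵀ := by
  intro W hWA hWB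
  set P := clusterProj S.vbar I with hP
  set E := stackedProj S.vbar I with hE
  have hPP : ∀ y, P *ᵥ (Pᵀ *ᵥ y) = y := hI.clusterProj_mulVec_transpose S.vbar_pos
  have hE' : ∀ x : Fin 4 × Fin r → ℝ, ∀ a, (fun j => (Eᵀ *ᵥ x) (a, j)) = Pᵀ *ᵥ fun i => x (a, i) :=
    fun x a => funext fun j => transpose_stackedProj_mulVec x a j
  have hA : ∀ x : Fin 4 × Fin r → ℝ, ∀ a, (fun i => ((S.redA S.vbar I)ᵀ *ᵥ x) (a, i)) =
      P *ᵥ fun j => (S.Aᵀ *ᵥ (Eᵀ *ᵥ x)) (a, j) := by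
    intro x a
    ext i
    simp only [redA, transpose_mul, transpose_transpose, ← mulVec_mulVec]
    exact stackedProj_mulVec _ a i
  have h3 : ∀ x ∈ W, (fun i => x (3, i)) = 0 := by
    intro x hx
    have := hWB x hx
    rw [redB, transpose_mul, ← mulVec_mulVec] at this
    have := S.eq_zero_of_B_transpose_mulVec this
    rw [← hPP fun i => x (3, i), ← hE', this, mulVec_zero]
  have h2 : ∀ x ∈ W, (fun i => x (2, i)) = 0 := by
    intro x hx
    have := h3 _ (hWA x hx)
    rwa [hA, A_transpose_mulVec_three, hE', hE', h3 x hx, mulVec_zero, sub_zero, hPP] at this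
  have h1 : ∀ x ∈ W, (fun i => x (1, i)) = 0 := by
    intro x hx
    have := h2 _ (hWA x hx)
    rw [hA, A_transpose_mulVec_two, hE', hE', hE', h3 x hx, h2 x hx, mulVec_zero, mulVec_zero,
      mulVec_zero, add_zero, add_zero, mulVec_mulVec, mulVec_mulVec] at this
    exact S.redF₁m_injective hF_dom hF_sign hF_det hI this
  have h0 : ∀ x ∈ W, (fun i => x (0, i)) = 0 := by
    intro x hx
    have := h1 _ (hWA x hx)
    rwa [hA, A_transpose_mulVec_one, hE', hE', h1 x hx, mulVec_zero, mulVec_zero, sub_zero,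
      hPP] at this
  refine (Submodule.eq_bot_iff W).2 fun x hx => ?_
  ext ⟨a, i⟩
  fin_cases a
  · exact congrFun (h0 x hx) i
  · exact congrFun (h1 x hx) i
  · exact congrFun (h2 x hx) i
  · exact congrFun (h3 x hx) i

theorem transpose_stackedProj_mulVec_redv₀ (hI : IsClusteringSet I) :
    (stackedProj S.vbar I)ᵀ *ᵥ S.redv₀ S.vbar I = S.v₀ := by
  ext ⟨a, j⟩
  rw [transpose_stackedProj_mulVec, redv₀]
  simp only [stackedProj_mulVec, v₀]
  by_cases ha : a = 0
  · simp only [ha, if_true]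
    exact congrFun (hI.transpose_clusterProj_mulVec_self S.vbar_pos) j
  · simp only [ha, if_false]
    change ((clusterProj S.vbar I)ᵀ *ᵥ (clusterProj S.vbar I *ᵥ 0)) j = 0
    simp

end PowerSystem

/-! ### Reduction and lifting of the consensus controller -/

theorem theorem1 {n r : ℕ} (S : PowerSystem n)
    (hF_dom : IsDiagDominant S.F₁)
    (hF_sign : (∀ i, 0 ≤ S.F₁ i i) ∨ (∀ i, S.F₁ i i ≤ 0))
    (hF_det : IsUnit S.F₁.det)
    (Q : Matrix (Fin 4 × Fin n) (Fin 4 × Fin n) ℝ) (hQ : Q.PosSemidef)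
    (hQ_ker : LinearMap.ker (Matrix.toLin' Q) = Submodule.span ℝ {S.v₀})
    (R : Matrix (Fin n) (Fin n) ℝ) (hR : R.PosDef)
    (I : Fin r → Finset (Fin n)) (hI : IsClusteringSet I)
    (hA_dec : ∃ wt : Fin 4 × Fin r → ℝ,
      IsZeroModeDual (S.redA S.vbar I) (S.redv₀ S.vbar I) wt) :
    ∃ K : Matrix (Fin n) (Fin 4 × Fin n) ℝ,
      (∀ ε : ℝ, 0 < ε → ∀ wt : Fin 4 × Fin r → ℝ,
        IsZeroModeDual (S.redA S.vbar I) (S.redv₀ S.vbar I) wt →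
        S.IsControlInversion Q R S.vbar I ε wt K) ∧
      Module.End.HasEigenvector (Matrix.toLin' (S.A - S.B * K)) 0 S.v₀ := by
  have hEv := S.transpose_stackedProj_mulVec_redv₀ hI
  have hAv : S.redA S.vbar I *ᵥ S.redv₀ S.vbar I = 0 := by
    rw [PowerSystem.redA, ← mulVec_mulVec, hEv, ← mulVec_mulVec, S.A_mulVec_v₀, mulVec_zero]
  have hQv₀ : Q *ᵥ S.v₀ = 0 := by
    have : S.v₀ ∈ LinearMap.ker (Matrix.toLin' Q) := by
      rw [hQ_ker]
      exact Submodule.mem_span_singleton_self _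
    simpa using this
  have hQr : (stackedProj S.vbar I * Q * (stackedProj S.vbar I)ᵀ).PosSemidef := by
    simpa using hQ.mul_mul_conjTranspose_same (stackedProj S.vbar I)
  have hQrv : (stackedProj S.vbar I * Q * (stackedProj S.vbar I)ᵀ) *ᵥ S.redv₀ S.vbar I = 0 := by
    rw [← mulVec_mulVec, hEv, ← mulVec_mulVec, hQv₀, mulVec_zero]
  have hQrker : ∀ x, (stackedProj S.vbar I * Q * (stackedProj S.vbar I)ᵀ) *ᵥ x = 0 →
      ∃ c : ℝ, x = c • S.redv₀ S.vbar I := by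
    intro x hx
    -- The form of `Q̃` at `x` is the form of `Q` at `Πᵀx`; semidefiniteness passes from form to
    -- vector, and `ΠΠᵀ = 1` brings the kernel back.
    have h1 : Q *ᵥ ((stackedProj S.vbar I)ᵀ *ᵥ x) = 0 := by
      apply hQ.mulVec_eq_zero
      have := congrArg (x ⬝ᵥ ·) hx
      simp only [← mulVec_mulVec, dotProduct_zero] at this
      rwa [dotProduct_mulVec, ← mulVec_transpose] at this
    have h2 : (stackedProj S.vbar I)ᵀ *ᵥ x ∈ Submodule.span ℝ {S.v₀} := by
      rw [← hQ_ker]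
      simpa using h1
    obtain ⟨c, hc⟩ := Submodule.mem_span_singleton.1 h2
    refine ⟨c, ?_⟩
    rw [← hI.stackedProj_mulVec_transpose S.vbar_pos x, ← hc, mulVec_smul, PowerSystem.redv₀]
  obtain ⟨X, hXv, hX⟩ := exists_isCPLQR hAv hQr hQrv hQrker hR
    (S.isControllable_red hF_dom hF_sign hF_det hI) hA_dec
  refine ⟨R⁻¹ * S.Bᵀ * ((stackedProj S.vbar I)ᵀ * X * stackedProj S.vbar I),
    fun ε hε wt hwt => ⟨X, hX ε hε wt hwt, rfl⟩, ?_⟩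
  rw [Module.End.hasEigenvector_iff, Module.End.mem_eigenspace_iff]
  constructor
  · have hred : stackedProj S.vbar I *ᵥ S.v₀ = S.redv₀ S.vbar I := rfl
    simp only [toLin'_apply, sub_mulVec, S.A_mulVec_v₀, ← mulVec_mulVec, hred, hXv, mulVec_zero,
      sub_zero, zero_smul]
  · intro h0
    -- A nonempty cluster supplies a generator, hence a positive entry of `v₀`.
    obtain ⟨j, -⟩ := hI.nonempty ⟨0, hI.r_pos⟩
    have := congrFun h0 (0, j)
    exact (S.vbar_pos j).ne' (by simpa [PowerSystem.v₀] using this)
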